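/- Let $\mathcal H,\mathcal K$ be nonzero finite-dimensional complex Hilbert spaces, let $\mathbf S$ be a nonempty finite set and let $\mathfrak I=\{\mathcal N_s\}_{s\in\mathbf S}$ be a finite family of completely positive trace preserving maps $\mathcal B(\mathcal H)\to\mathcal B(\mathcal K)$ (a finite arbitrarily varying quantum channel). Write $\mathcal C(\mathcal H,\mathcal K)$ for the set of all such maps and $\mathcal N_{s^l}:=\mathcal N_{s_1}\otimes\dots\otimes\mathcal N_{s_l}$ for $s^l\in\mathbf S^l$. A random code of block length $l$ and dimension $k_l\ge 1$ consists of Hilbert spaces $\mathcal F_l\subset\mathcal F_l'$ of finite dimension, $\dim\mathcal F_l=k_l$, and a probability measure $\mu_l$ on a $\sigma$-algebra $\sigma_l$ on $\mathcal C(\mathcal F_l,\mathcal H^{\otimes l})\times\mathcal C(\mathcal K^{\otimes l},\mathcal F_l')$ that contains all singletons; it is deterministic if $\mu_l$ is a point measure. For an encoder-decoder pair $(\mathcal P,\mathcal R)$ and $s^l\in\mathbf S^l$ put $\Lambda:=\mathcal R\circ\mathcal N_{s^l}\circ\mathcal P$. The code is an entanglement transmission code if, for every $s^l$, the entanglement fidelity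 $(\mathcal P,\mathcal R)\mapsto F_e(\pi_{\mathcal F_l},\Lambda)=\langle\psi,(\mathrm{id}\otimes\Lambda)(|\psi\rangle\langle\psi|)\psi\rangle$ is $\sigma_l$-measurable, where $\psi\in\mathcal F_l\otimes\mathcal F_l$ is a purification of the maximally mixed state $\pi_{\mathcal F_l}$. It is a strong subspace transmission code if $(\mathcal P,\mathcal R)\mapsto\langle\phi,\Lambda(|\phi\rangle\langle\phi|)\phi\rangle$ is $\sigma_l$-measurable for every $s^l$ and every unit vector $\phi\in\mathcal F_l$. Let $\lambda\in[0,1]$. A number $R\ge0$ is an achievable entanglement transmission rate with random codes and error $\lambda$ if there is a sequence of random entanglement transmission codes, one for each block length $l$, such that $$\liminf_{l\to\infty}\frac1l\log_2k_l\ge R\quad\text{and}\quad\liminf_{l\to\infty}\inf_{s^l\in\mathbf S^l}\int F_e(\pi_{\mathcal F_l},\mathcal R\circ\mathcal N_{s^l}\circ\mathcal P)\,d\mu_l(\mathcal P,\mathcal R)\ge1-\lambda .$$ It is an achievable strong subspace transmission rate with random codes and error $\lambda$ if there is a sequence of random strong subspace transmission codes, one for each block length $l$, such that $$\liminf_{l\to\infty}\frac1l\log_2k_l\ge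 R\quad\text{and}\quad\liminf_{l\to\infty}\inf_{s^l\in\mathbf S^l}\ \min_{\phi\in\mathcal F_l,\ \|\phi\|=1}\int\langle\phi,(\mathcal R\circ\mathcal N_{s^l}\circ\mathcal P)(|\phi\rangle\langle\phi|)\phi\rangle\,d\mu_l(\mathcal P,\mathcal R)\ge1-\lambda .$$ It is achievable with deterministic codes if the codes in the sequence can be chosen deterministic. Let $\mathcal A_{\mathrm{random}}(\mathfrak I,\lambda)$, $\mathcal A_{\mathrm{det}}(\mathfrak I,\lambda)$, $\mathcal A_{\mathrm{s,random}}(\mathfrak I,\lambda)$, $\mathcal A_{\mathrm{s,det}}(\mathfrak I,\lambda)\in[0,\infty]$ be the suprema of the respective sets of achievable rates. **Theorem.** For every finite arbitrarily varying quantum channel $\mathfrak I$ and every $\lambda\in[0,1]$, $$\mathcal A_{\mathrm{det}}(\mathfrak I,\lambda)=\mathcal A_{\mathrm{s,det}}(\mathfrak I,\lambda)\qquad\text{and}\qquad\mathcal A_{\mathrm{random}}(\mathfrak I,\lambda)=\mathcal A_{\mathrm{s,random}}(\mathfrak I,\lambda).$$ -/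

import Mathlib

noncomputable section

namespace AVQC

open Matrix MeasureTheory Filter
open scoped NNReal ENNReal ComplexOrder

/-! The Hilbert space with an orthonormal basis indexed by the finite type `a` is `ℂ^a`;
operators on it are the matrices `Matrix a a ℂ`. The `l`-fold tensor power of `ℂ^a` is
`ℂ^(Fin l → a)`. -/

/-- Linear maps from the operators on `ℂ^a` to the operators on `ℂ^b`. -/
abbrev SuperOp (a b : Type*) : Type _ := Matrix a a ℂ →ₗ[ℂ] Matrix b b ℂ

/-- `(id ⊗ Φ)(X)`, for an operator `X` on `ℂ^r ⊗ ℂ^a = ℂ^(r × a)`. -/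
def idTensor (r : Type*) {a b : Type*} (Φ : SuperOp a b) (X : Matrix (r × a) (r × a) ℂ) :
    Matrix (r × b) (r × b) ℂ :=
  Matrix.of fun p q => Φ (Matrix.of fun x y => X (p.1, x) (q.1, y)) p.2 q.2

/-- Quantum channels: the set `C(ℂ^a, ℂ^b)` of completely positive trace preserving maps. -/
structure Channel (a b : Type*) [Fintype a] [Fintype b] where
  toMap : SuperOp a b
  completelyPositive : ∀ (r : ℕ) (X : Matrix (Fin r × a) (Fin r × a) ℂ),
    X.PosSemidef → (idTensor (Fin r) toMap X).PosSemidef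
  tracePreserving : ∀ X : Matrix a a ℂ, (toMap X).trace = X.trace

/-- The tensor product `Φ 0 ⊗ ⋯ ⊗ Φ (l - 1)` of linear maps on operators, given by its values
on matrix units. -/
def tensorMap {a b : Type*} [Fintype a] [DecidableEq a] {l : ℕ} (Φ : Fin l → SuperOp a b) :
    SuperOp (Fin l → a) (Fin l → b) where
  toFun X := Matrix.of fun i j => ∑ x : Fin l → a, ∑ y : Fin l → a,
    X x y * ∏ t, Φ t (Matrix.single (x t) (y t) 1) (i t) (j t)
  map_add' X Y := by
    ext i j
    simp [add_mul, Finset.sum_add_distrib]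
  map_smul' c X := by
    ext i j
    simp [mul_assoc, Finset.mul_sum]

/-- The defining property of the tensor product: its action on product operators. -/
theorem tensorMap_prod {a b : Type*} [Fintype a] [DecidableEq a] {l : ℕ}
    (Φ : Fin l → SuperOp a b) (A : Fin l → Matrix a a ℂ) :
    tensorMap Φ (Matrix.of fun x y => ∏ t, A t (x t) (y t)) =
      Matrix.of fun i j => ∏ t, Φ t (A t) (i t) (j t) := by
  ext i j
  have h : ∀ t, Φ t (A t) (i t) (j t) =
      ∑ p : a × a, A t p.1 p.2 * Φ t (Matrix.single p.1 p.2 1) (i t) (j t) := by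
    intro t
    conv_lhs => rw [Matrix.matrix_eq_sum_single (A t)]
    rw [Fintype.sum_prod_type]
    simp only [map_sum, Matrix.sum_apply]
    refine Finset.sum_congr rfl fun x _ => Finset.sum_congr rfl fun y _ => ?_
    have : Matrix.single x y (A t x y) = A t x y • Matrix.single x y (1 : ℂ) := by simp
    rw [this, map_smul, Matrix.smul_apply, smul_eq_mul]
  simp only [tensorMap, LinearMap.coe_mk, AddHom.coe_mk, Matrix.of_apply, h]
  rw [Finset.prod_univ_sum, Fintype.piFinset_univ, ← Fintype.sum_prod_type']
  refine Fintype.sum_equiv (Equiv.arrowProdEquivProdArrow (Fin l) (fun _ => a) (fun _ => a)).symm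
    _ _ fun p => ?_
  simp [Equiv.arrowProdEquivProdArrow, Finset.prod_mul_distrib]

/-- The channel `N_{s^l} = N_{s_1} ⊗ ⋯ ⊗ N_{s_l}`. -/
def wordMap {a b S : Type*} [Fintype a] [Fintype b] [DecidableEq a] (N : S → Channel a b)
    {l : ℕ} (s : Fin l → S) : SuperOp (Fin l → a) (Fin l → b) :=
  tensorMap fun t => (N (s t)).toMap

/-- The rank one operator `|v⟩⟨v|`. -/
def ketBra {a : Type*} (v : a → ℂ) : Matrix a a ℂ := Matrix.vecMulVec v (star v)

/-- The (real part of the) quadratic form `⟨v, A v⟩`. -/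
def expVal {a : Type*} [Fintype a] (A : Matrix a a ℂ) (v : a → ℂ) : ℝ := (star v ⬝ᵥ (A *ᵥ v)).re

/-- Fidelity `⟨Vφ, Λ(|φ⟩⟨φ|) Vφ⟩` of the output of `Λ : B(F) → B(F')` at the input `|φ⟩⟨φ|`,
where `F` is regarded as a subspace of `F'` through the isometry `V`. -/
def pureFidelity {f g : Type*} [Fintype f] [Fintype g] (V : Matrix g f ℂ) (Λ : SuperOp f g)
    (φ : f → ℂ) : ℝ :=
  expVal (Λ (ketBra φ)) (V *ᵥ φ)

/-- The state vector `ψ ∈ F ⊗ F` (reference system first) is a purification of `ρ`. -/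
def IsPurification {f : Type*} [Fintype f] (ψ : f × f → ℂ) (ρ : Matrix f f ℂ) : Prop :=
  ∀ x y, ∑ r, ψ (r, x) * star (ψ (r, y)) = ρ x y

/-- `⟨(1 ⊗ V)ψ, (id ⊗ Λ)(|ψ⟩⟨ψ|) (1 ⊗ V)ψ⟩`: the entanglement fidelity of `Λ : B(F) → B(F')` at
the state purified by `ψ`, with `F` regarded as a subspace of `F'` through `V`. -/
def purifiedFidelity {f g : Type*} [Fintype f] [Fintype g] (V : Matrix g f ℂ) (Λ : SuperOp f g)
    (ψ : f × f → ℂ) : ℝ :=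
  expVal (idTensor f Λ (ketBra ψ)) fun p => (V *ᵥ fun x => ψ (p.1, x)) p.2

/-- The entanglement fidelity depends only on the state, not on the purification. -/
theorem purifiedFidelity_eq {f g : Type*} [Fintype f] [Fintype g] (V : Matrix g f ℂ)
    (Λ : SuperOp f g) (ψ ψ' : f × f → ℂ) (ρ : Matrix f f ℂ) (h : IsPurification ψ ρ)
    (h' : IsPurification ψ' ρ) : purifiedFidelity V Λ ψ = purifiedFidelity V Λ ψ' := by
  classical
  suffices H : ∀ χ : f × f → ℂ, IsPurification χ ρ → purifiedFidelity V Λ χ =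
      (∑ i, ∑ j, ∑ x, ∑ y, (∑ z, ρ x z * star (V i z)) * star (∑ z, ρ y z * star (V j z)) *
        Λ (Matrix.single x y 1) i j).re by rw [H ψ h, H ψ' h']
  intro χ hχ
  have hT : ∀ x i, ∑ z, ρ x z * star (V i z) =
      ∑ r, χ (r, x) * star ((V *ᵥ fun w => χ (r, w)) i) := by
    intro x i
    simp only [← hχ x, Matrix.mulVec, dotProduct, star_sum, Finset.mul_sum, Finset.sum_mul,
      star_mul']
    rw [Finset.sum_comm]
    exact Finset.sum_congr rfl fun r _ => Finset.sum_congr rfl fun z _ => by ring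
  have hM : ∀ r r' i j, Λ (Matrix.of fun x y => χ (r, x) * star (χ (r', y))) i j =
      ∑ x, ∑ y, χ (r, x) * star (χ (r', y)) * Λ (Matrix.single x y 1) i j := by
    intro r r' i j
    conv_lhs => rw [Matrix.matrix_eq_sum_single (Matrix.of fun x y => χ (r, x) * star (χ (r', y)))]
    simp only [map_sum, Matrix.sum_apply]
    refine Finset.sum_congr rfl fun x _ => Finset.sum_congr rfl fun y _ => ?_
    have : Matrix.single x y (χ (r, x) * star (χ (r', y))) =
        (χ (r, x) * star (χ (r', y))) • Matrix.single x y (1 : ℂ) := by simp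
    rw [Matrix.of_apply, this, map_smul, Matrix.smul_apply, smul_eq_mul]
  have hS : ∀ G : f → g → f → g → f → f → ℂ,
      ∑ r, ∑ i, ∑ r', ∑ j, ∑ x, ∑ y, G r i r' j x y =
        ∑ i, ∑ j, ∑ x, ∑ y, ∑ r, ∑ r', G r i r' j x y := by
    intro G
    rw [Finset.sum_comm]
    refine Finset.sum_congr rfl fun i _ => ?_
    trans ∑ r, ∑ j, ∑ x, ∑ y, ∑ r', G r i r' j x y
    · refine Finset.sum_congr rfl fun r _ => ?_
      rw [Finset.sum_comm]
      refine Finset.sum_congr rfl fun j _ => ?_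
      rw [Finset.sum_comm]
      exact Finset.sum_congr rfl fun x _ => Finset.sum_comm
    · rw [Finset.sum_comm]
      refine Finset.sum_congr rfl fun j _ => ?_
      rw [Finset.sum_comm]
      exact Finset.sum_congr rfl fun x _ => Finset.sum_comm
  simp only [hT]
  unfold purifiedFidelity expVal
  generalize hW : (fun (r : f) (i : g) => (V *ᵥ fun w => χ (r, w)) i) = W
  have hW' : ∀ r i, (V *ᵥ fun w => χ (r, w)) i = W r i := fun r i => by rw [← hW]
  congr 1
  trans ∑ r, ∑ i, ∑ r', ∑ j, ∑ x, ∑ y,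
    star (W r i) * (χ (r, x) * star (χ (r', y)) * Λ (Matrix.single x y 1) i j * W r' j)
  · simp only [hW']
    simp only [dotProduct, Matrix.mulVec, Fintype.sum_prod_type, idTensor, Matrix.of_apply,
      ketBra, Matrix.vecMulVec_apply, Pi.star_apply, hM, Finset.sum_mul, Finset.mul_sum]
  · rw [hS]
    simp only [hW', star_sum, star_mul', star_star, Finset.sum_mul, Finset.mul_sum]
    refine Finset.sum_congr rfl fun i _ => Finset.sum_congr rfl fun j _ =>
      Finset.sum_congr rfl fun x _ => Finset.sum_congr rfl fun y _ => ?_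
    rw [Finset.sum_comm]
    exact Finset.sum_congr rfl fun r _ => Finset.sum_congr rfl fun r' _ => by ring

/-- The maximally mixed state `π_F` on `F = ℂ^k`. -/
def maxMixed (k : ℕ) : Matrix (Fin k) (Fin k) ℂ := (k : ℂ)⁻¹ • 1

/-- The maximally entangled vector `k^{-1/2} ∑ e_i ⊗ e_i`. -/
def maxEntangled (k : ℕ) : Fin k × Fin k → ℂ :=
  fun p => if p.1 = p.2 then ((Real.sqrt k)⁻¹ : ℝ) else 0

theorem maxEntangled_isPurification (k : ℕ) : IsPurification (maxEntangled k) (maxMixed k) := by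
  intro x y
  have h : (((Real.sqrt k)⁻¹ : ℝ) : ℂ) * (((Real.sqrt k)⁻¹ : ℝ) : ℂ) = (k : ℂ)⁻¹ := by
    rw [← Complex.ofReal_mul, ← mul_inv, Real.mul_self_sqrt (Nat.cast_nonneg k)]
    simp
  by_cases hxy : x = y
  · subst hxy
    simp only [maxEntangled, maxMixed]
    rw [Finset.sum_eq_single x]
    · simpa using h
    · intro r _ hr
      simp [hr]
    · simp
  · rw [Finset.sum_eq_zero]
    · simp [maxMixed, hxy]
    · intro r _
      by_cases hr : r = x
      · subst hr
        simp [maxEntangled, hxy]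
      · simp [maxEntangled, hr]

/-- The entanglement fidelity `F_e(π_F, Λ)` at the maximally mixed state. -/
def entanglementFidelity {k : ℕ} {g : Type*} [Fintype g] (V : Matrix g (Fin k) ℂ)
    (Λ : SuperOp (Fin k) g) : ℝ :=
  purifiedFidelity V Λ (maxEntangled k)

/-- Pairs of an encoder in `C(F_l, H^{⊗l})` and a decoder in `C(K^{⊗l}, F_l')`, where
`H = ℂ^a`, `K = ℂ^b`, `F_l = ℂ^k`, `F_l' = ℂ^d`. -/
abbrev CodePair (a b : Type*) [Fintype a] [Fintype b] (l k d : ℕ) : Type _ :=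
  Channel (Fin k) (Fin l → a) × Channel (Fin l → b) (Fin d)

/-- The map `R ∘ N_{s^l} ∘ P`. -/
def CodePair.total {a b S : Type*} [Fintype a] [Fintype b] [DecidableEq a] {l k d : ℕ}
    (p : CodePair a b l k d) (N : S → Channel a b) (s : Fin l → S) : SuperOp (Fin k) (Fin d) :=
  p.2.toMap ∘ₗ wordMap N s ∘ₗ p.1.toMap

/-- A probability measure on encoder-decoder pairs with `dim F_l = k`, together with the
sigma-algebra it lives on and the inclusion `F_l ⊂ F_l'` (the isometry `V`). Which functions
have to be measurable depends on the transmission task, see below. -/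
structure RandomCode (a b : Type*) [Fintype a] [Fintype b] (l k : ℕ) where
  pos : 0 < k
  d : ℕ
  V : Matrix (Fin d) (Fin k) ℂ
  isometry : Vᴴ * V = 1
  sigma : MeasurableSpace (CodePair a b l k d)
  singleton : ∀ p : CodePair a b l k d, MeasurableSet[sigma] {p}
  μ : @Measure (CodePair a b l k d) sigma
  isProb : IsProbabilityMeasure μ

namespace RandomCode

variable {a b S : Type*} [Fintype a] [Fintype b] [DecidableEq a] {l k : ℕ}

/-- Deterministic codes: the measure is a point measure. -/
def IsDeterministic (C : RandomCode a b l k) : Prop :=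
  ∃ p : CodePair a b l k C.d, C.μ {p} = 1 ∧ ∀ A, MeasurableSet[C.sigma] A → p ∉ A → C.μ A = 0

/-- `C` is a random entanglement transmission code for the AVQC given by `N`. -/
def IsEntanglementCode (C : RandomCode a b l k) (N : S → Channel a b) : Prop :=
  ∀ s : Fin l → S, Measurable[C.sigma] fun p : CodePair a b l k C.d =>
    entanglementFidelity C.V (p.total N s)

/-- `C` is a random strong subspace transmission code for the AVQC given by `N`. -/
def IsStrongSubspaceCode (C : RandomCode a b l k) (N : S → Channel a b) : Prop :=
  ∀ (s : Fin l → S) (φ : Fin k → ℂ), star φ ⬝ᵥ φ = 1 →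
    Measurable[C.sigma] fun p : CodePair a b l k C.d => pureFidelity C.V (p.total N s) φ

/-- `inf_{s^l} ∫ F_e(π_F, R ∘ N_{s^l} ∘ P) dμ(P, R)`. -/
def entanglementPerformance (C : RandomCode a b l k) (N : S → Channel a b) : ℝ :=
  ⨅ s : Fin l → S, @integral _ ℝ _ _ C.sigma C.μ fun p => entanglementFidelity C.V (p.total N s)

/-- `inf_{s^l} inf_φ ∫ ⟨φ, R ∘ N_{s^l} ∘ P (|φ⟩⟨φ|) φ⟩ dμ(P, R)`, over all unit vectors `φ ∈ F`. -/
def strongSubspacePerformance (C : RandomCode a b l k) (N : S → Channel a b) : ℝ :=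
  ⨅ s : Fin l → S, ⨅ φ : {φ : Fin k → ℂ // star φ ⬝ᵥ φ = 1},
    @integral _ ℝ _ _ C.sigma C.μ fun p => pureFidelity C.V (p.total N s) φ

end RandomCode

/-- `liminf_{l → ∞} (1/l) log₂ k_l`, an extended real number. -/
def asymptoticRate (k : ℕ → ℕ) : EReal :=
  liminf (fun l : ℕ => ((1 / (l : ℝ) * Real.logb 2 (k l) : ℝ) : EReal)) atTop

section Capacities

variable {a b S : Type*} [Fintype a] [Fintype b] [DecidableEq a]

/-- `R` is an achievable entanglement transmission rate with random codes and error `lam`. -/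
def AchievableRandom (N : S → Channel a b) (lam : ℝ) (R : ℝ≥0) : Prop :=
  ∃ (k : ℕ → ℕ) (C : ∀ l, RandomCode a b l (k l)),
    (∀ l, (C l).IsEntanglementCode N) ∧
    ((R : ℝ) : EReal) ≤ asymptoticRate k ∧
    1 - lam ≤ liminf (fun l => (C l).entanglementPerformance N) atTop

/-- `R` is an achievable entanglement transmission rate with deterministic codes and error
`lam`. -/
def AchievableDet (N : S → Channel a b) (lam : ℝ) (R : ℝ≥0) : Prop :=
  ∃ (k : ℕ → ℕ) (C : ∀ l, RandomCode a b l (k l)),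
    (∀ l, (C l).IsEntanglementCode N) ∧ (∀ l, (C l).IsDeterministic) ∧
    ((R : ℝ) : EReal) ≤ asymptoticRate k ∧
    1 - lam ≤ liminf (fun l => (C l).entanglementPerformance N) atTop

/-- `R` is an achievable strong subspace transmission rate with random codes and error `lam`. -/
def StrongAchievableRandom (N : S → Channel a b) (lam : ℝ) (R : ℝ≥0) : Prop :=
  ∃ (k : ℕ → ℕ) (C : ∀ l, RandomCode a b l (k l)),
    (∀ l, (C l).IsStrongSubspaceCode N) ∧
    ((R : ℝ) : EReal) ≤ asymptoticRate k ∧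
    1 - lam ≤ liminf (fun l => (C l).strongSubspacePerformance N) atTop

/-- `R` is an achievable strong subspace transmission rate with deterministic codes and error
`lam`. -/
def StrongAchievableDet (N : S → Channel a b) (lam : ℝ) (R : ℝ≥0) : Prop :=
  ∃ (k : ℕ → ℕ) (C : ∀ l, RandomCode a b l (k l)),
    (∀ l, (C l).IsStrongSubspaceCode N) ∧ (∀ l, (C l).IsDeterministic) ∧
    ((R : ℝ) : EReal) ≤ asymptoticRate k ∧
    1 - lam ≤ liminf (fun l => (C l).strongSubspacePerformance N) atTop

/-- The capacity `A_random(I, lam)`, with values in `[0, ∞]`. -/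
def capRandom (N : S → Channel a b) (lam : ℝ) : ℝ≥0∞ :=
  ⨆ (R : ℝ≥0) (_ : AchievableRandom N lam R), (R : ℝ≥0∞)

/-- The capacity `A_det(I, lam)`, with values in `[0, ∞]`. -/
def capDet (N : S → Channel a b) (lam : ℝ) : ℝ≥0∞ :=
  ⨆ (R : ℝ≥0) (_ : AchievableDet N lam R), (R : ℝ≥0∞)

/-- The capacity `A_{s,random}(I, lam)`, with values in `[0, ∞]`. -/
def capStrongRandom (N : S → Channel a b) (lam : ℝ) : ℝ≥0∞ :=
  ⨆ (R : ℝ≥0) (_ : StrongAchievableRandom N lam R), (R : ℝ≥0∞)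

/-- The capacity `A_{s,det}(I, lam)`, with values in `[0, ∞]`. -/
def capStrongDet (N : S → Channel a b) (lam : ℝ) : ℝ≥0∞ :=
  ⨆ (R : ℝ≥0) (_ : StrongAchievableDet N lam R), (R : ℝ≥0∞)

end Capacities

end AVQC

end

/-!
The two capacities agree because codes for one task are converted into codes for the other at an
asymptotically negligible cost.

For a fixed encoder-decoder pair and a fixed word `s`, let `Kₙ` be Kraus operators of
`R ∘ N_s ∘ P` and put `Aₙ = V* Kₙ`, so that `∑ₙ Aₙ* Aₙ ≤ 1`. The fidelity of a vector is
`∑ₙ |⟨φ, Aₙ φ⟩|²` and the entanglement fidelity is `∑ₙ |tr Aₙ / k|²`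
(`CodePair.exists_operators`).

*From strong subspace to entanglement transmission.* Averaging the vector fidelity over the vectors
with entries `± k^{-1/2}` gives at most `F_e + 2 / k` (`IsSubnormalized.avg_flatVec_le`), and `k` tends
to infinity at a positive rate. The entanglement fidelity need not be measurable for the
sigma-algebra of the given code, because it is not a function of the vector fidelities when
`F_l'` is larger than `F_l`. Therefore the measure is first replaced by one of finite support
with almost the same values of the finitely many integrals in question
(`RandomCode.exists_finite_average`).

*From entanglement to strong subspace transmission, random codes.* Encoder and decoder share a random
signed cyclic shift. These unitaries average every operator to a multiple of the identity, so that
convexity of `|·|²` bounds the averaged fidelity of every vector below by `F_e`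
(`traceFid_le_avg_signedShift`).

*From entanglement to strong subspace transmission, deterministic codes.* The vector fidelity is
bounded below by `2 ⟨φ, H φ⟩ - F_e` for a Hermitian contraction `H` of trace `k F_e`
(`IsSubnormalized.exists_quadraticForm`). Such forms concentrate: on the range of a Gaussian
`k × m` matrix exponentially many of them (in `l`) are simultaneously almost at least `tr H / k`,
by a union bound over the words `s` and a net of the unit sphere of `ℂ^m`
(`exists_isometry_expVal_le`). This works for `m = ⌈2 ^ (l R')⌉` with any `R'` below the rate of the
given codes, so that the restricted codes achieve every smaller rate.
-/

namespace AVQC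

open Matrix MeasureTheory Filter
open scoped NNReal ENNReal ComplexOrder

/-! ### Kraus representations -/

/-- The squared Euclidean norm of a vector of `ℂ^a`. -/
noncomputable def sqNorm {a : Type*} [Fintype a] (v : a → ℂ) : ℝ := ∑ x, ‖v x‖ ^ 2

theorem sqNorm_nonneg {a : Type*} [Fintype a] (v : a → ℂ) : 0 ≤ sqNorm v :=
  Finset.sum_nonneg fun _ _ => by positivity

theorem star_dotProduct_self {a : Type*} [Fintype a] (v : a → ℂ) :
    star v ⬝ᵥ v = (sqNorm v : ℂ) := by
  simp only [dotProduct, sqNorm, Pi.star_apply, Complex.ofReal_sum]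
  refine Finset.sum_congr rfl fun x _ => ?_
  rw [RCLike.star_def, Complex.conj_mul']
  push_cast
  rfl

theorem star_dotProduct_self_eq_one_iff {a : Type*} [Fintype a] (v : a → ℂ) :
    star v ⬝ᵥ v = 1 ↔ sqNorm v = 1 := by
  rw [star_dotProduct_self]
  norm_cast

/-- The spectral decomposition of a Hermitian matrix, in coordinates. -/
theorem _root_.Matrix.IsHermitian.apply_eq_sum {n : Type*} [Fintype n] [DecidableEq n]
    {M : Matrix n n ℂ} (hM : M.IsHermitian) (x y : n) :
    M x y = ∑ i, (hM.eigenvalues i : ℂ) * (hM.eigenvectorUnitary.1 x i *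
      star (hM.eigenvectorUnitary.1 y i)) := by
  conv_lhs => rw [hM.spectral_theorem, Unitary.conjStarAlgAut_apply]
  simp only [Matrix.mul_apply, Matrix.diagonal_apply, Function.comp_apply, mul_ite, mul_zero,
    Finset.sum_ite_eq', Finset.mem_univ, if_true, Matrix.star_apply]
  refine Finset.sum_congr rfl fun i _ => ?_
  simp only [Complex.coe_algebraMap, RCLike.star_def]
  change _ * (hM.eigenvalues i : ℂ) * _ = _
  ring

section Kraus

variable {a b c ι κ : Type*} [Fintype ι] [Fintype κ]

theorem superOp_apply_eq_sum [Fintype a] [DecidableEq a] (Φ : SuperOp a b) (X : Matrix a a ℂ)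
    (i j : b) : Φ X i j = ∑ x, ∑ y, X x y * Φ (Matrix.single x y 1) i j := by
  conv_lhs => rw [Matrix.matrix_eq_sum_single X]
  simp only [map_sum, Matrix.sum_apply]
  refine Finset.sum_congr rfl fun x _ => Finset.sum_congr rfl fun y _ => ?_
  have : Matrix.single x y (X x y) = X x y • Matrix.single x y (1 : ℂ) := by simp
  rw [this, map_smul, Matrix.smul_apply, smul_eq_mul]

/-- The operators `K n` are Kraus operators of the map `Φ`. -/
def IsKraus [Fintype a] (K : ι → Matrix b a ℂ) (Φ : SuperOp a b) : Prop :=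
  ∀ X, Φ X = ∑ n, K n * X * (K n)ᴴ

theorem IsKraus.apply_single [Fintype a] [DecidableEq a] {K : ι → Matrix b a ℂ} {Φ : SuperOp a b}
    (h : IsKraus K Φ) (x y : a) (i j : b) :
    Φ (Matrix.single x y 1) i j = ∑ n, K n i x * star (K n j y) := by
  rw [h, Matrix.sum_apply]
  refine Finset.sum_congr rfl fun n _ => ?_
  simp only [Matrix.mul_apply, Matrix.single_apply, Matrix.conjTranspose_apply]
  rw [Finset.sum_eq_single y]
  · simp
  · intro z _ hz
    simp [hz.symm]
  · simp

theorem isKraus_of_apply_single [Fintype a] [DecidableEq a] {K : ι → Matrix b a ℂ}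
    {Φ : SuperOp a b}
    (h : ∀ x y i j, Φ (Matrix.single x y 1) i j = ∑ n, K n i x * star (K n j y)) :
    IsKraus K Φ := by
  intro X
  ext i j
  rw [superOp_apply_eq_sum, Matrix.sum_apply]
  simp only [h, Matrix.mul_apply, Matrix.conjTranspose_apply, Finset.mul_sum, Finset.sum_mul]
  have : ∀ G : a → a → ι → ℂ, ∑ x, ∑ y, ∑ n, G x y n = ∑ n, ∑ y, ∑ x, G x y n := by
    intro G
    trans ∑ n, ∑ x, ∑ y, G x y n
    · rw [Finset.sum_comm (s := (Finset.univ : Finset ι))]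
      exact Finset.sum_congr rfl fun x _ => Finset.sum_comm
    · exact Finset.sum_congr rfl fun n _ => Finset.sum_comm
  rw [this]
  exact Finset.sum_congr rfl fun n _ => Finset.sum_congr rfl fun y _ =>
    Finset.sum_congr rfl fun x _ => by ring

/-- A channel has Kraus operators: they are the eigenvectors of its Choi matrix, which is
positive semidefinite, scaled by the square roots of the eigenvalues. -/
theorem Channel.exists_isKraus [Fintype a] [Fintype b] (N : Channel a b) :
    ∃ (r : ℕ) (K : Fin r → Matrix b a ℂ), IsKraus K N.toMap := by
  classical
  let e := Fintype.equivFin a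
  -- The unnormalized maximally entangled vector.
  let ω : Fin (Fintype.card a) × a → ℂ := fun p => if p.1 = e p.2 then 1 else 0
  have hC : (idTensor (Fin (Fintype.card a)) N.toMap (vecMulVec ω (star ω))).PosSemidef :=
    N.completelyPositive _ _ (Matrix.posSemidef_vecMulVec_self_star ω)
  have hchoi : ∀ x y i j, idTensor (Fin (Fintype.card a)) N.toMap (vecMulVec ω (star ω))
      (e x, i) (e y, j) = N.toMap (Matrix.single x y 1) i j := by
    intro x y i j
    have : (Matrix.of fun x' y' => vecMulVec ω (star ω) (e x, x') (e y, y')) =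
        Matrix.single x y (1 : ℂ) := by
      ext x' y'
      by_cases h1 : x = x' <;> by_cases h2 : y = y' <;>
        simp [vecMulVec_apply, ω, h1, h2]
    simp only [idTensor, Matrix.of_apply, this]
  let σ := Fintype.equivFin (Fin (Fintype.card a) × b)
  refine ⟨_, fun n => Matrix.of fun i x => (Real.sqrt (hC.1.eigenvalues (σ.symm n)) : ℂ) *
    hC.1.eigenvectorUnitary.1 (e x, i) (σ.symm n), isKraus_of_apply_single fun x y i j => ?_⟩
  rw [← hchoi, hC.1.apply_eq_sum]
  refine Fintype.sum_equiv σ _ _ fun n => ?_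
  have h0 := hC.eigenvalues_nonneg n
  have h1 : (hC.1.eigenvalues n : ℂ) = (Real.sqrt (hC.1.eigenvalues n) : ℂ) *
      (Real.sqrt (hC.1.eigenvalues n) : ℂ) := by
    rw [← Complex.ofReal_mul, Real.mul_self_sqrt h0]
  simp only [Equiv.symm_apply_apply, Matrix.of_apply, star_mul', RCLike.star_def,
    Complex.conj_ofReal]
  conv_lhs => rw [h1]
  ring

theorem IsKraus.comp [Fintype a] [Fintype b] {K : ι → Matrix c b ℂ} {L : κ → Matrix b a ℂ}
    {Ψ : SuperOp b c} {Φ : SuperOp a b} (hK : IsKraus K Ψ) (hL : IsKraus L Φ) :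
    IsKraus (fun p : ι × κ => K p.1 * L p.2) (Ψ ∘ₗ Φ) := by
  intro X
  rw [LinearMap.comp_apply, hL, hK, Fintype.sum_prod_type]
  simp only [Matrix.mul_sum, Matrix.sum_mul, Matrix.conjTranspose_mul, Matrix.mul_assoc]

theorem IsKraus.tensorMap [Fintype a] [DecidableEq a] {l : ℕ} {ι : Fin l → Type*}
    [∀ t, Fintype (ι t)] {Φ : Fin l → SuperOp a b} {K : ∀ t, ι t → Matrix b a ℂ}
    (h : ∀ t, IsKraus (K t) (Φ t)) :
    IsKraus (fun (ν : ∀ t, ι t) => Matrix.of fun (i : Fin l → b) (x : Fin l → a) =>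
      ∏ t, K t (ν t) (i t) (x t)) (tensorMap Φ) := by
  classical
  refine isKraus_of_apply_single fun x y i j => ?_
  have h1 : AVQC.tensorMap Φ (Matrix.single x y 1) i j =
      ∏ t, Φ t (Matrix.single (x t) (y t) 1) (i t) (j t) := by
    simp only [AVQC.tensorMap, LinearMap.coe_mk, AddHom.coe_mk, Matrix.of_apply]
    rw [Finset.sum_eq_single x, Finset.sum_eq_single y]
    · simp
    · intro z _ hz
      simp [hz.symm]
    · simp
    · intro z _ hz
      refine Finset.sum_eq_zero fun w _ => ?_
      simp [hz.symm]
    · simp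
  rw [h1]
  simp only [fun t => (h t).apply_single, Finset.prod_univ_sum, Fintype.piFinset_univ,
    Matrix.of_apply, star_prod, Finset.prod_mul_distrib]

theorem trace_tensorMap [Fintype a] [DecidableEq a] [Fintype b] {l : ℕ}
    {Φ : Fin l → SuperOp a b} (h : ∀ t X, (Φ t X).trace = X.trace)
    (X : Matrix (Fin l → a) (Fin l → a) ℂ) : (tensorMap Φ X).trace = X.trace := by
  classical
  have h1 : ∀ x y : Fin l → a, ∑ i : Fin l → b,
      ∏ t, Φ t (Matrix.single (x t) (y t) 1) (i t) (i t) = if x = y then 1 else 0 := by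
    intro x y
    have h2 := Finset.prod_univ_sum (fun _ : Fin l => (Finset.univ : Finset b))
      (fun t i => Φ t (Matrix.single (x t) (y t) 1) i i)
    rw [Fintype.piFinset_univ] at h2
    rw [← h2]
    have h3 : ∀ t, ∑ i, Φ t (Matrix.single (x t) (y t) 1) i i = if x t = y t then 1 else 0 := by
      intro t
      refine (h t (Matrix.single (x t) (y t) 1)).trans ?_
      by_cases hxy : x t = y t
      · simp [hxy]
      · simp [hxy, Matrix.trace_single_eq_of_ne]
    simp only [h3]
    rw [Finset.prod_ite_zero]
    simp [funext_iff]
  simp only [Matrix.trace, Matrix.diag_apply, tensorMap, LinearMap.coe_mk, AddHom.coe_mk,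
    Matrix.of_apply]
  rw [Finset.sum_comm]
  refine Finset.sum_congr rfl fun x _ => ?_
  rw [Finset.sum_comm]
  simp only [← Finset.mul_sum, h1]
  simp

end Kraus

/-! ### Fidelities of a coded transmission -/

section Fidelity

variable {ι : Type*} [Fintype ι]

theorem expVal_sum_ketBra {g : Type*} [Fintype g] (w : ι → g → ℂ) (v : g → ℂ) :
    expVal (∑ n, ketBra (w n)) v = ∑ n, ‖star v ⬝ᵥ w n‖ ^ 2 := by
  simp only [expVal, Matrix.sum_mulVec, dotProduct_sum, Complex.re_sum]
  refine Finset.sum_congr rfl fun n _ => ?_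
  have h : star v ⬝ᵥ ketBra (w n) *ᵥ v = (star v ⬝ᵥ w n) * star (star v ⬝ᵥ w n) := by
    rw [ketBra, Matrix.vecMulVec_mulVec, dotProduct_smul, op_smul_eq_mul,
      Matrix.star_dotProduct (w n) v]
  rw [h, RCLike.star_def, Complex.mul_conj', ← Complex.ofReal_pow, Complex.ofReal_re]

theorem mul_ketBra_mul {f g : Type*} [Fintype f] (K : Matrix g f ℂ) (v : f → ℂ) :
    K * ketBra v * Kᴴ = ketBra (K *ᵥ v) := by
  rw [ketBra, ketBra, Matrix.mul_vecMulVec, Matrix.vecMulVec_mul, Matrix.star_mulVec]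

theorem star_mulVec_dotProduct {f g : Type*} [Fintype f] [Fintype g] (V : Matrix g f ℂ)
    (v : f → ℂ) (w : g → ℂ) : star (V *ᵥ v) ⬝ᵥ w = star v ⬝ᵥ (Vᴴ *ᵥ w) := by
  rw [Matrix.star_mulVec, Matrix.dotProduct_mulVec]

theorem pureFidelity_eq_sum {f g : Type*} [Fintype f] [Fintype g] (V : Matrix g f ℂ)
    {Λ : SuperOp f g} {K : ι → Matrix g f ℂ} (hK : IsKraus K Λ) (φ : f → ℂ) :
    pureFidelity V Λ φ = ∑ n, ‖star φ ⬝ᵥ ((Vᴴ * K n) *ᵥ φ)‖ ^ 2 := by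
  rw [pureFidelity, hK]
  simp only [mul_ketBra_mul, expVal_sum_ketBra, star_mulVec_dotProduct, Matrix.mulVec_mulVec]

theorem entanglementFidelity_eq_sum {k : ℕ} {g : Type*} [Fintype g] (V : Matrix g (Fin k) ℂ)
    {Λ : SuperOp (Fin k) g} {K : ι → Matrix g (Fin k) ℂ} (hK : IsKraus K Λ) :
    entanglementFidelity V Λ = ∑ n, ‖(k : ℂ)⁻¹ * (Vᴴ * K n).trace‖ ^ 2 := by
  set ψ := maxEntangled k with hψ
  have h1 : idTensor (Fin k) Λ (ketBra ψ) =
      ∑ n, ketBra fun p : Fin k × g => (K n *ᵥ fun x => ψ (p.1, x)) p.2 := by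
    ext p q
    have h2 : (Matrix.of fun x y => ketBra ψ (p.1, x) (q.1, y)) =
        vecMulVec (fun x => ψ (p.1, x)) (star fun x => ψ (q.1, x)) := by
      ext x y
      simp [ketBra, vecMulVec_apply]
    simp only [idTensor, Matrix.of_apply, h2]
    rw [hK, Matrix.sum_apply, Matrix.sum_apply]
    refine Finset.sum_congr rfl fun n _ => ?_
    rw [Matrix.mul_vecMulVec, Matrix.vecMulVec_mul, ← Matrix.star_mulVec]
    simp [ketBra, vecMulVec_apply]
  have h3 : ∀ r : Fin k, (fun x => ψ (r, x)) =
      (((Real.sqrt k)⁻¹ : ℝ) : ℂ) • Pi.single r (1 : ℂ) := by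
    intro r
    ext x
    by_cases hx : r = x
    · subst hx
      simp [hψ, maxEntangled]
    · simp [hψ, maxEntangled, hx, Ne.symm hx]
  have h4 : (((Real.sqrt k)⁻¹ : ℝ) : ℂ) * (((Real.sqrt k)⁻¹ : ℝ) : ℂ) = (k : ℂ)⁻¹ := by
    rw [← Complex.ofReal_mul, ← mul_inv, Real.mul_self_sqrt (Nat.cast_nonneg k)]
    simp
  rw [entanglementFidelity, purifiedFidelity, ← hψ, h1, expVal_sum_ketBra]
  refine Finset.sum_congr rfl fun n _ => ?_
  congr 2
  have h5 : ∀ r : Fin k, star (V *ᵥ fun x => ψ (r, x)) ⬝ᵥ (K n *ᵥ fun x => ψ (r, x)) =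
      (k : ℂ)⁻¹ * (Vᴴ * K n) r r := by
    intro r
    rw [star_mulVec_dotProduct, Matrix.mulVec_mulVec, h3, Matrix.mulVec_smul, star_smul,
      smul_dotProduct, dotProduct_smul, smul_smul, Matrix.mulVec_single_one]
    rw [RCLike.star_def, Complex.conj_ofReal, h4, smul_eq_mul, ← Pi.single_star,
      star_one, single_one_dotProduct]
    rfl
  trans ∑ r : Fin k, star (V *ᵥ fun x => ψ (r, x)) ⬝ᵥ (K n *ᵥ fun x => ψ (r, x))
  · rw [dotProduct, Fintype.sum_prod_type]
    rfl
  · simp only [h5, ← Finset.mul_sum, Matrix.trace, Matrix.diag_apply]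

theorem sqNorm_conjTranspose_mulVec_le {f g : Type*} [Fintype f] [DecidableEq f] [Fintype g]
    {V : Matrix g f ℂ} (hV : Vᴴ * V = 1) (w : g → ℂ) : sqNorm (Vᴴ *ᵥ w) ≤ sqNorm w := by
  have h : (sqNorm (w - V *ᵥ (Vᴴ *ᵥ w)) : ℂ) = sqNorm w - sqNorm (Vᴴ *ᵥ w) := by
    have h1 : star w ⬝ᵥ V *ᵥ (Vᴴ *ᵥ w) = star (Vᴴ *ᵥ w) ⬝ᵥ (Vᴴ *ᵥ w) := by
      rw [star_mulVec_dotProduct, Matrix.conjTranspose_conjTranspose]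
    have h3 : star (V *ᵥ (Vᴴ *ᵥ w)) ⬝ᵥ w = star (Vᴴ *ᵥ w) ⬝ᵥ (Vᴴ *ᵥ w) :=
      star_mulVec_dotProduct _ _ _
    have h4 : star (V *ᵥ (Vᴴ *ᵥ w)) ⬝ᵥ (V *ᵥ (Vᴴ *ᵥ w)) = star (Vᴴ *ᵥ w) ⬝ᵥ (Vᴴ *ᵥ w) := by
      rw [star_mulVec_dotProduct, Matrix.mulVec_mulVec (Vᴴ *ᵥ w) Vᴴ V, hV, Matrix.one_mulVec]
    rw [← star_dotProduct_self, ← star_dotProduct_self, ← star_dotProduct_self, star_sub,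
      sub_dotProduct, dotProduct_sub, dotProduct_sub, h1, h3, h4]
    ring
  have h2 : sqNorm (w - V *ᵥ (Vᴴ *ᵥ w)) = sqNorm w - sqNorm (Vᴴ *ᵥ w) := by exact_mod_cast h
  linarith [sqNorm_nonneg (w - V *ᵥ (Vᴴ *ᵥ w))]

theorem sqNorm_mulVec_of_isometry {f g : Type*} [Fintype f] [DecidableEq f] [Fintype g]
    {V : Matrix g f ℂ} (hV : Vᴴ * V = 1) (v : f → ℂ) : sqNorm (V *ᵥ v) = sqNorm v := by
  have h : (sqNorm (V *ᵥ v) : ℂ) = sqNorm v := by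
    rw [← star_dotProduct_self, ← star_dotProduct_self, star_mulVec_dotProduct,
      Matrix.mulVec_mulVec, hV, Matrix.one_mulVec]
  exact_mod_cast h

theorem trace_ketBra {f : Type*} [Fintype f] (v : f → ℂ) :
    (ketBra v).trace = (sqNorm v : ℂ) := by
  rw [ketBra, Matrix.trace_vecMulVec, dotProduct_comm, star_dotProduct_self]

/-- The operators `A n` satisfy `∑ₙ Aₙ* Aₙ ≤ 1`. -/
def IsSubnormalized {f : Type*} [Fintype f] (A : ι → Matrix f f ℂ) : Prop :=
  ∀ φ, ∑ n, sqNorm (A n *ᵥ φ) ≤ sqNorm φ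

theorem isSubnormalized_of_isKraus {f g : Type*} [Fintype f] [DecidableEq f] [Fintype g]
    {V : Matrix g f ℂ} (hV : Vᴴ * V = 1) {Λ : SuperOp f g} {K : ι → Matrix g f ℂ}
    (hK : IsKraus K Λ) (hΛ : ∀ X, (Λ X).trace = X.trace) :
    IsSubnormalized fun n => Vᴴ * K n := by
  intro φ
  have h1 : ∑ n, sqNorm (K n *ᵥ φ) = sqNorm φ := by
    have h2 := hΛ (ketBra φ)
    simp only [hK (ketBra φ), Matrix.trace_sum, mul_ketBra_mul, trace_ketBra] at h2
    exact_mod_cast h2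
  rw [← h1]
  refine Finset.sum_le_sum fun n _ => ?_
  rw [← Matrix.mulVec_mulVec]
  exact sqNorm_conjTranspose_mulVec_le hV _

/-- For each word `s`, the fidelities of a coded transmission are those of the operators
`Aₙ = V* Kₙ`, where `Kₙ` are Kraus operators of `R ∘ N_s ∘ P`. -/
theorem CodePair.exists_operators {a b S : Type*} [Fintype a] [Fintype b] [DecidableEq a]
    {l k d : ℕ} (p : CodePair a b l k d) (N : S → Channel a b) (s : Fin l → S)
    {V : Matrix (Fin d) (Fin k) ℂ} (hV : Vᴴ * V = 1) :
    ∃ (ι : Type) (_ : Fintype ι) (A : ι → Matrix (Fin k) (Fin k) ℂ), IsSubnormalized A ∧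
      (∀ φ, pureFidelity V (p.total N s) φ = ∑ n, ‖star φ ⬝ᵥ (A n *ᵥ φ)‖ ^ 2) ∧
      entanglementFidelity V (p.total N s) = ∑ n, ‖(k : ℂ)⁻¹ * (A n).trace‖ ^ 2 := by
  obtain ⟨r₁, K₁, h₁⟩ := p.1.exists_isKraus
  obtain ⟨r₂, K₂, h₂⟩ := p.2.exists_isKraus
  choose r K hK using fun s => (N s).exists_isKraus
  have hN : IsKraus _ (wordMap N s) := IsKraus.tensorMap fun t => hK (s t)
  have hT := h₂.comp (hN.comp h₁)
  refine ⟨_, inferInstance, _, isSubnormalized_of_isKraus hV hT fun X => ?_,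
    pureFidelity_eq_sum V hT, entanglementFidelity_eq_sum V hT⟩
  rw [LinearMap.comp_apply, LinearMap.comp_apply, p.2.tracePreserving, wordMap,
    trace_tensorMap fun t => (N (s t)).tracePreserving, p.1.tracePreserving]

end Fidelity

/-! ### Averages over signs -/

section Signs

variable {k : ℕ}

/-- The entry `ε x` of a sign vector, as a complex number. -/
noncomputable def sgn (ε : Fin k → ℤˣ) (x : Fin k) : ℂ := ((ε x : ℤ) : ℂ)

theorem sgn_mul_self (ε : Fin k → ℤˣ) (x : Fin k) : sgn ε x * sgn ε x = 1 := by
  rw [sgn, ← Int.cast_mul, ← Units.val_mul, Int.units_mul_self]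
  simp

theorem star_sgn (ε : Fin k → ℤˣ) (x : Fin k) : star (sgn ε x) = sgn ε x := by
  simp [sgn]

theorem sgn_flip (ε : Fin k → ℤˣ) (x y : Fin k) :
    sgn (Pi.mulSingle x (-1) * ε) y = (if y = x then -1 else 1) * sgn ε y := by
  by_cases h : y = x
  · subst h
    simp [sgn]
  · simp [sgn, h]

/-- A function of the signs that is odd in one of them has mean zero. -/
theorem sum_signs_eq_zero (g : (Fin k → ℤˣ) → ℂ) (x : Fin k)
    (h : ∀ ε, g (Pi.mulSingle x (-1) * ε) = -g ε) : ∑ ε, g ε = 0 := by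
  have h1 : ∑ ε, g (Pi.mulSingle x (-1) * ε) = ∑ ε, g ε :=
    Fintype.sum_equiv (Equiv.mulLeft (Pi.mulSingle x (-1) : Fin k → ℤˣ)) _ _ fun _ => rfl
  simp only [h, Finset.sum_neg_distrib] at h1
  exact self_eq_neg.mp h1.symm

theorem card_signs : Fintype.card (Fin k → ℤˣ) = 2 ^ k := by
  simp

theorem sum_sgn_mul_sgn (x y : Fin k) :
    ∑ ε : Fin k → ℤˣ, sgn ε x * sgn ε y = if x = y then 2 ^ k else 0 := by
  split_ifs with h
  · subst h
    simp [sgn_mul_self]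
  · refine sum_signs_eq_zero _ x fun ε => ?_
    simp [sgn_flip, Ne.symm h]

theorem sum_sgn_four {x y x' y' : Fin k} (h : x ≠ y) (h' : x' ≠ y') :
    ∑ ε : Fin k → ℤˣ, sgn ε x * sgn ε y * (sgn ε x' * sgn ε y') =
      2 ^ k * ((if (x', y') = (x, y) then 1 else 0) + if (x', y') = (y, x) then 1 else 0) := by
  by_cases h1 : x' = x
  · subst h1
    have : ∀ ε : Fin k → ℤˣ, sgn ε x' * sgn ε y * (sgn ε x' * sgn ε y') =
        sgn ε y * sgn ε y' := by
      intro ε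
      rw [mul_mul_mul_comm, sgn_mul_self, one_mul]
    simp only [this, sum_sgn_mul_sgn]
    rcases eq_or_ne y y' with rfl | hy
    · simp [h, h.symm]
    · simp [hy, hy.symm, h'.symm]
  by_cases h2 : y' = x
  · subst h2
    have : ∀ ε : Fin k → ℤˣ, sgn ε y' * sgn ε y * (sgn ε x' * sgn ε y') =
        sgn ε y * sgn ε x' := by
      intro ε
      have := sgn_mul_self ε y'
      linear_combination sgn ε y * sgn ε x' * this
    simp only [this, sum_sgn_mul_sgn]
    rcases eq_or_ne y x' with rfl | hy
    · simp [h']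
    · simp [hy, hy.symm, h']
  · rw [sum_signs_eq_zero _ x]
    · simp [h1, h2]
    · intro ε
      simp [sgn_flip, h1, h2, Ne.symm h]

/-- The average of `|∑ A x y ε x ε y|²` over the signs `ε`: its main term is `|tr A|²`. -/
theorem sum_signs_normSq_le (A : Matrix (Fin k) (Fin k) ℂ) :
    ∑ ε : Fin k → ℤˣ, ‖sgn ε ⬝ᵥ (A *ᵥ sgn ε)‖ ^ 2 ≤
      2 ^ k * (‖A.trace‖ ^ 2 + 2 * ∑ x, ∑ y, ‖A x y‖ ^ 2) := by
  -- The diagonal of `A` contributes `tr A` for all signs; `Z ε` is the off-diagonal part, which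
  -- has mean zero.
  let c : Fin k × Fin k → ℂ := fun p => if p.1 = p.2 then 0 else A p.1 p.2
  let Z : (Fin k → ℤˣ) → ℂ := fun ε => ∑ p, c p * (sgn ε p.1 * sgn ε p.2)
  have hsplit : ∀ ε : Fin k → ℤˣ, sgn ε ⬝ᵥ (A *ᵥ sgn ε) = A.trace + Z ε := by
    intro ε
    have h1 : ∀ x y, sgn ε x * (A x y * sgn ε y) =
        (if x = y then A x x else 0) + c (x, y) * (sgn ε x * sgn ε y) := by
      intro x y
      by_cases hxy : x = y
      · subst hxy
        simp only [c, if_true, zero_mul, add_zero]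
        linear_combination A x x * sgn_mul_self ε x
      · simp only [c, hxy, if_false, zero_add]
        ring
    simp only [dotProduct, Matrix.mulVec, Finset.mul_sum, h1, Finset.sum_add_distrib, Z,
      Fintype.sum_prod_type, Matrix.trace, Matrix.diag_apply]
    simp
  have hZ0 : ∑ ε, Z ε = 0 := by
    simp only [Z]
    rw [Finset.sum_comm]
    refine Finset.sum_eq_zero fun p _ => ?_
    rw [← Finset.mul_sum, sum_sgn_mul_sgn]
    by_cases hp : p.1 = p.2 <;> simp [c, hp]
  have hZ2 : ∑ ε, ‖Z ε‖ ^ 2 ≤ 2 ^ k * (2 * ∑ p, ‖c p‖ ^ 2) := by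
    -- The products `ε x ε y` are orthogonal, except that `(x, y)` and `(y, x)` give the same one.
    have h1 : ((∑ ε, ‖Z ε‖ ^ 2 : ℝ) : ℂ) =
        2 ^ k * ∑ p, c p * (star (c p) + star (c p.swap)) := by
      have h2 : ∀ ε, ((‖Z ε‖ ^ 2 : ℝ) : ℂ) = ∑ p, ∑ q, c p * star (c q) *
          (sgn ε p.1 * sgn ε p.2 * (sgn ε q.1 * sgn ε q.2)) := by
        intro ε
        rw [Complex.ofReal_pow, ← Complex.mul_conj', ← RCLike.star_def]
        simp only [Z, star_sum, Finset.sum_mul_sum, star_mul', star_sgn]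
        exact Finset.sum_congr rfl fun p _ => Finset.sum_congr rfl fun q _ => by ring
      have h3 : ∀ p q : Fin k × Fin k, ∑ ε : Fin k → ℤˣ, c p * star (c q) *
          (sgn ε p.1 * sgn ε p.2 * (sgn ε q.1 * sgn ε q.2)) = c p * star (c q) *
          (2 ^ k * ((if q = p then 1 else 0) + if q = p.swap then 1 else 0)) := by
        rintro ⟨x, y⟩ ⟨x', y'⟩
        by_cases h : x = y
        · simp [c, h]
        by_cases h' : x' = y'
        · simp [c, h']
        rw [← Finset.mul_sum, sum_sgn_four h h']
        rfl
      rw [Complex.ofReal_sum]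
      simp only [h2]
      rw [Finset.sum_comm, Finset.mul_sum]
      refine Finset.sum_congr rfl fun p _ => ?_
      rw [Finset.sum_comm]
      simp only [h3, mul_add, Finset.sum_add_distrib, mul_ite, mul_one, mul_zero,
        Finset.sum_ite_eq', Finset.mem_univ, if_true]
      ring
    have h4 : ∑ ε, ‖Z ε‖ ^ 2 = 2 ^ k * ∑ p, (c p * (star (c p) + star (c p.swap))).re := by
      have := congrArg Complex.re h1
      rw [Complex.ofReal_re, show (2 : ℂ) ^ k = ((2 ^ k : ℝ) : ℂ) by push_cast; rfl,
        Complex.re_ofReal_mul, Complex.re_sum] at this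
      exact this
    have h5 : ∀ z w : ℂ, (z * (star z + star w)).re ≤ 3 / 2 * ‖z‖ ^ 2 + 1 / 2 * ‖w‖ ^ 2 := by
      intro z w
      rw [Complex.sq_norm, Complex.sq_norm, Complex.normSq_apply, Complex.normSq_apply]
      simp only [RCLike.star_def, Complex.mul_re, Complex.add_re, Complex.add_im, Complex.conj_re,
        Complex.conj_im]
      nlinarith [sq_nonneg (z.re - w.re), sq_nonneg (z.im - w.im)]
    have h6 : ∑ p : Fin k × Fin k, ‖c p.swap‖ ^ 2 = ∑ p, ‖c p‖ ^ 2 :=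
      Equiv.sum_comp (Equiv.prodComm _ _) fun p => ‖c p‖ ^ 2
    rw [h4]
    refine mul_le_mul_of_nonneg_left ?_ (by positivity)
    calc _ ≤ ∑ p, (3 / 2 * ‖c p‖ ^ 2 + 1 / 2 * ‖c p.swap‖ ^ 2) :=
          Finset.sum_le_sum fun p _ => h5 _ _
      _ = 2 * ∑ p, ‖c p‖ ^ 2 := by
          rw [Finset.sum_add_distrib, ← Finset.mul_sum, ← Finset.mul_sum, h6]
          ring
  have hc : ∑ p, ‖c p‖ ^ 2 ≤ ∑ x, ∑ y, ‖A x y‖ ^ 2 := by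
    rw [Fintype.sum_prod_type]
    refine Finset.sum_le_sum fun x _ => Finset.sum_le_sum fun y _ => ?_
    by_cases hxy : x = y
    · simp [c, hxy]
    · simp [c, hxy]
  have hexp : ∀ ε, ‖A.trace + Z ε‖ ^ 2 =
      ‖A.trace‖ ^ 2 + 2 * (star A.trace * Z ε).re + ‖Z ε‖ ^ 2 := by
    intro ε
    rw [Complex.sq_norm, Complex.sq_norm, Complex.sq_norm, Complex.normSq_apply,
      Complex.normSq_apply, Complex.normSq_apply]
    simp only [RCLike.star_def, Complex.mul_re, Complex.add_re, Complex.add_im, Complex.conj_re,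
      Complex.conj_im]
    ring
  simp only [hsplit, hexp, Finset.sum_add_distrib]
  rw [← Finset.mul_sum, ← Complex.re_sum, ← Finset.mul_sum, hZ0]
  simp only [Finset.sum_const, Finset.card_univ, card_signs, nsmul_eq_mul, mul_zero,
    Complex.zero_re, add_zero, Nat.cast_pow, Nat.cast_ofNat]
  nlinarith [mul_le_mul_of_nonneg_left hc (show (0 : ℝ) ≤ 2 ^ k by positivity)]

end Signs

/-! ### Pure state fidelity against entanglement fidelity -/

section Families

variable {k : ℕ} {ι : Type*} [Fintype ι]

/-- The fidelity of the vector state `φ` under the map with Kraus operators `A n`. -/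
noncomputable def vecFid (A : ι → Matrix (Fin k) (Fin k) ℂ) (φ : Fin k → ℂ) : ℝ :=
  ∑ n, ‖star φ ⬝ᵥ (A n *ᵥ φ)‖ ^ 2

/-- The entanglement fidelity of the map with Kraus operators `A n`, at the maximally mixed
state. -/
noncomputable def traceFid (A : ι → Matrix (Fin k) (Fin k) ℂ) : ℝ :=
  ∑ n, ‖(k : ℂ)⁻¹ * (A n).trace‖ ^ 2

theorem vecFid_nonneg (A : ι → Matrix (Fin k) (Fin k) ℂ) (φ : Fin k → ℂ) : 0 ≤ vecFid A φ :=
  Finset.sum_nonneg fun _ _ => by positivity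

theorem traceFid_nonneg (A : ι → Matrix (Fin k) (Fin k) ℂ) : 0 ≤ traceFid A :=
  Finset.sum_nonneg fun _ _ => by positivity

theorem norm_dotProduct_sq_le {f : Type*} [Fintype f] (v w : f → ℂ) :
    ‖star v ⬝ᵥ w‖ ^ 2 ≤ sqNorm v * sqNorm w := by
  have h : ‖star v ⬝ᵥ w‖ ≤ ∑ x, ‖v x‖ * ‖w x‖ := by
    refine (norm_sum_le _ _).trans_eq (Finset.sum_congr rfl fun x _ => ?_)
    simp
  calc ‖star v ⬝ᵥ w‖ ^ 2 ≤ (∑ x, ‖v x‖ * ‖w x‖) ^ 2 := by gcongr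
    _ ≤ _ := Finset.sum_mul_sq_le_sq_mul_sq _ _ _

theorem IsSubnormalized.vecFid_le_one {A : ι → Matrix (Fin k) (Fin k) ℂ} (hA : IsSubnormalized A)
    {φ : Fin k → ℂ} (hφ : sqNorm φ = 1) : vecFid A φ ≤ 1 := by
  calc vecFid A φ ≤ ∑ n, sqNorm φ * sqNorm (A n *ᵥ φ) :=
        Finset.sum_le_sum fun n _ => norm_dotProduct_sq_le _ _
    _ ≤ 1 := by
        have := hA φ
        rw [hφ] at this
        simpa only [hφ, one_mul] using this

theorem IsSubnormalized.sum_entries_le {A : ι → Matrix (Fin k) (Fin k) ℂ}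
    (hA : IsSubnormalized A) : ∑ n, ∑ x, ∑ y, ‖A n x y‖ ^ 2 ≤ k := by
  have h : ∀ y, ∑ n, ∑ x, ‖A n x y‖ ^ 2 ≤ 1 := by
    intro y
    have := hA (Pi.single y 1)
    simp only [sqNorm, Matrix.mulVec_single_one, Matrix.col_apply] at this
    refine this.trans_eq ?_
    rw [Finset.sum_eq_single y]
    · simp
    · intro z _ hz
      simp [hz]
    · simp
  calc ∑ n, ∑ x, ∑ y, ‖A n x y‖ ^ 2 = ∑ y, ∑ n, ∑ x, ‖A n x y‖ ^ 2 := by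
        rw [Finset.sum_comm (s := (Finset.univ : Finset (Fin k)))]
        exact Finset.sum_congr rfl fun n _ => Finset.sum_comm
    _ ≤ ∑ _y : Fin k, 1 := Finset.sum_le_sum fun y _ => h y
    _ = k := by simp

theorem IsSubnormalized.traceFid_le_one {A : ι → Matrix (Fin k) (Fin k) ℂ}
    (hA : IsSubnormalized A) : traceFid A ≤ 1 := by
  rcases Nat.eq_zero_or_pos k with rfl | hk
  · simp [traceFid]
  have hk' : (0 : ℝ) < k := by exact_mod_cast hk
  have h : ∀ n, ‖(k : ℂ)⁻¹ * (A n).trace‖ ^ 2 ≤ (k : ℝ)⁻¹ * ∑ x, ∑ y, ‖A n x y‖ ^ 2 := by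
    intro n
    have h1 : ‖(A n).trace‖ ^ 2 ≤ k * ∑ x, ‖A n x x‖ ^ 2 := by
      calc ‖(A n).trace‖ ^ 2 ≤ (∑ x, ‖A n x x‖) ^ 2 := by
            gcongr
            exact norm_sum_le _ _
        _ ≤ _ := by simpa using sq_sum_le_card_mul_sum_sq (s := Finset.univ) (f := fun x => ‖A n x x‖)
    have h2 : ∑ x, ‖A n x x‖ ^ 2 ≤ ∑ x, ∑ y, ‖A n x y‖ ^ 2 :=
      Finset.sum_le_sum fun x _ => Finset.single_le_sum
        (f := fun y => ‖A n x y‖ ^ 2) (fun _ _ => by positivity) (Finset.mem_univ x)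
    rw [norm_mul, norm_inv, Complex.norm_natCast, mul_pow]
    calc (k : ℝ)⁻¹ ^ 2 * ‖(A n).trace‖ ^ 2 ≤ (k : ℝ)⁻¹ ^ 2 * (k * ∑ x, ∑ y, ‖A n x y‖ ^ 2) := by
          gcongr
          exact h1.trans (by gcongr)
      _ = _ := by field_simp
  calc traceFid A ≤ ∑ n, (k : ℝ)⁻¹ * ∑ x, ∑ y, ‖A n x y‖ ^ 2 :=
        Finset.sum_le_sum fun n _ => h n
    _ ≤ (k : ℝ)⁻¹ * k := by
        rw [← Finset.mul_sum]
        gcongr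
        exact hA.sum_entries_le
    _ = 1 := inv_mul_cancel₀ hk'.ne'

/-- The unit vector with entries `± k^{-1/2}`. -/
noncomputable def flatVec (ε : Fin k → ℤˣ) : Fin k → ℂ := (((Real.sqrt k)⁻¹ : ℝ) : ℂ) • sgn ε

theorem sqNorm_flatVec (hk : 0 < k) (ε : Fin k → ℤˣ) : sqNorm (flatVec ε) = 1 := by
  have h : ∀ x, ‖sgn ε x‖ = 1 := by
    intro x
    rcases Int.units_eq_one_or (ε x) with h | h <;> simp [sgn, h]
  simp only [sqNorm, flatVec, Pi.smul_apply, smul_eq_mul, norm_mul, h, mul_one, Complex.norm_real,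
    norm_inv, Real.norm_eq_abs, sq_abs, inv_pow, Real.sq_sqrt (Nat.cast_nonneg k)]
  have : (k : ℝ) ≠ 0 := by exact_mod_cast hk.ne'
  simp [this]

/-- Averaging over the flat vectors overestimates the entanglement fidelity by at most `2 / k`. -/
theorem IsSubnormalized.avg_flatVec_le {A : ι → Matrix (Fin k) (Fin k) ℂ} (hk : 0 < k)
    (hA : IsSubnormalized A) :
    ((2 : ℝ) ^ k)⁻¹ * ∑ ε : Fin k → ℤˣ, vecFid A (flatVec ε) ≤ traceFid A + 2 / k := by
  have hk' : (0 : ℝ) < k := by exact_mod_cast hk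
  have h1 : ∀ (ε : Fin k → ℤˣ) n, ‖star (flatVec ε) ⬝ᵥ (A n *ᵥ flatVec ε)‖ ^ 2 =
      (k : ℝ)⁻¹ ^ 2 * ‖sgn ε ⬝ᵥ (A n *ᵥ sgn ε)‖ ^ 2 := by
    intro ε n
    have hs : star (sgn ε) = sgn ε := funext fun x => star_sgn ε x
    rw [flatVec, Matrix.mulVec_smul, star_smul, smul_dotProduct, dotProduct_smul, hs, smul_smul,
      RCLike.star_def, Complex.conj_ofReal, ← Complex.ofReal_mul, ← mul_inv,
      Real.mul_self_sqrt (Nat.cast_nonneg k), smul_eq_mul, norm_mul, mul_pow]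
    simp
  have h2 : ∑ ε : Fin k → ℤˣ, vecFid A (flatVec ε) ≤
      ∑ n, (k : ℝ)⁻¹ ^ 2 * (2 ^ k * (‖(A n).trace‖ ^ 2 + 2 * ∑ x, ∑ y, ‖A n x y‖ ^ 2)) := by
    simp only [vecFid, h1]
    rw [Finset.sum_comm]
    refine Finset.sum_le_sum fun n _ => ?_
    rw [← Finset.mul_sum]
    gcongr
    exact sum_signs_normSq_le _
  have h3 : ∑ n, (k : ℝ)⁻¹ ^ 2 * (2 ^ k * (‖(A n).trace‖ ^ 2 + 2 * ∑ x, ∑ y, ‖A n x y‖ ^ 2)) =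
      2 ^ k * (traceFid A + 2 * (k : ℝ)⁻¹ ^ 2 * ∑ n, ∑ x, ∑ y, ‖A n x y‖ ^ 2) := by
    simp only [traceFid, norm_mul, norm_inv, Complex.norm_natCast, mul_pow]
    rw [Finset.mul_sum Finset.univ _ (2 * (k : ℝ)⁻¹ ^ 2), ← Finset.sum_add_distrib,
      Finset.mul_sum]
    exact Finset.sum_congr rfl fun n _ => by ring
  rw [inv_mul_le_iff₀ (by positivity)]
  refine h2.trans (h3.trans_le ?_)
  gcongr
  calc 2 * (k : ℝ)⁻¹ ^ 2 * ∑ n, ∑ x, ∑ y, ‖A n x y‖ ^ 2 ≤ (2 : ℝ) * (k : ℝ)⁻¹ ^ 2 * (k : ℝ) := by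
        gcongr
        exact hA.sum_entries_le
    _ = 2 / (k : ℝ) := by field_simp

/-- The signed cyclic shift `e_y ↦ ε_{y + c} e_{y + c}`. -/
noncomputable def signedShift [NeZero k] (ε : Fin k → ℤˣ) (c : Fin k) :
    Matrix (Fin k) (Fin k) ℂ :=
  Matrix.of fun x y => if y = x - c then sgn ε x else 0

theorem signedShift_mulVec [NeZero k] (ε : Fin k → ℤˣ) (c : Fin k) (φ : Fin k → ℂ) (x : Fin k) :
    (signedShift ε c *ᵥ φ) x = sgn ε x * φ (x - c) := by
  simp [Matrix.mulVec, dotProduct, signedShift]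

theorem signedShift_isometry [NeZero k] (ε : Fin k → ℤˣ) (c : Fin k) :
    (signedShift ε c)ᴴ * signedShift ε c = 1 := by
  ext y z
  simp only [Matrix.mul_apply, Matrix.conjTranspose_apply, signedShift, Matrix.of_apply,
    Matrix.one_apply]
  rw [Finset.sum_eq_single (y + c)]
  · by_cases h : y = z
    · subst h
      simp [sgn_mul_self, -RCLike.star_def, star_sgn]
    · simp [h, Ne.symm h]
  · intro x _ hx
    have : y ≠ x - c := fun h => hx (by rw [h, sub_add_cancel])
    simp [this]
  · simp

/-- The signed shifts average every operator to a multiple of the identity. By convexity of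
`|·|²` the average of the fidelities of `U φ` is at least the entanglement fidelity. -/
theorem traceFid_le_avg_signedShift [NeZero k] (A : ι → Matrix (Fin k) (Fin k) ℂ)
    {φ : Fin k → ℂ} (hφ : sqNorm φ = 1) :
    traceFid A ≤ ((2 : ℝ) ^ k * k)⁻¹ *
      ∑ u : (Fin k → ℤˣ) × Fin k, vecFid A (signedShift u.1 u.2 *ᵥ φ) := by
  have hk' : (0 : ℝ) < k := by exact_mod_cast Nat.pos_of_ne_zero (NeZero.ne k)
  let t : ι → (Fin k → ℤˣ) × Fin k → ℂ := fun n u =>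
    star (signedShift u.1 u.2 *ᵥ φ) ⬝ᵥ (A n *ᵥ (signedShift u.1 u.2 *ᵥ φ))
  have hsum : ∀ n, ∑ u, t n u = 2 ^ k * (A n).trace := by
    intro n
    have h1 : ∀ u : (Fin k → ℤˣ) × Fin k, t n u = ∑ x, ∑ y,
        (star (φ (x - u.2)) * A n x y * φ (y - u.2)) * (sgn u.1 x * sgn u.1 y) := by
      intro u
      have h0 : signedShift u.1 u.2 *ᵥ φ = fun x => sgn u.1 x * φ (x - u.2) :=
        funext fun x => signedShift_mulVec _ _ _ _
      simp only [t]
      rw [h0]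
      simp only [dotProduct, Matrix.mulVec, Pi.star_apply, star_mul',
        star_sgn, Finset.mul_sum]
      exact Finset.sum_congr rfl fun x _ => Finset.sum_congr rfl fun y _ => by ring
    have h2 : ∀ c : Fin k, ∑ ε : Fin k → ℤˣ, t n (ε, c) =
        ∑ x, 2 ^ k * (A n x x * ((‖φ (x - c)‖ ^ 2 : ℝ) : ℂ)) := by
      intro c
      simp only [h1]
      rw [Finset.sum_comm]
      refine Finset.sum_congr rfl fun x _ => ?_
      rw [Finset.sum_comm]
      simp only [← Finset.mul_sum, sum_sgn_mul_sgn, mul_ite, mul_zero, Finset.sum_ite_eq,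
        Finset.mem_univ, if_true]
      rw [Complex.ofReal_pow, ← Complex.conj_mul', RCLike.star_def]
      ring
    have h3 : ∀ x : Fin k, ∑ c, ((‖φ (x - c)‖ ^ 2 : ℝ) : ℂ) = 1 := by
      intro x
      have h4 : ∑ c, ((‖φ (x - c)‖ ^ 2 : ℝ) : ℂ) = ∑ y, ((‖φ y‖ ^ 2 : ℝ) : ℂ) :=
        Fintype.sum_equiv (Equiv.subLeft x) _ _ fun _ => rfl
      rw [h4, ← Complex.ofReal_sum]
      exact_mod_cast hφ
    rw [Fintype.sum_prod_type, Finset.sum_comm]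
    simp only [h2]
    rw [Finset.sum_comm]
    simp only [← Finset.mul_sum, h3, mul_one]
    rfl
  have hn : ∀ n, ‖(k : ℂ)⁻¹ * (A n).trace‖ ^ 2 ≤ ((2 : ℝ) ^ k * k)⁻¹ * ∑ u, ‖t n u‖ ^ 2 := by
    intro n
    have h1 : ‖∑ u, t n u‖ ^ 2 ≤ (2 ^ k * k) * ∑ u, ‖t n u‖ ^ 2 := by
      calc ‖∑ u, t n u‖ ^ 2 ≤ (∑ u, ‖t n u‖) ^ 2 := by
            gcongr
            exact norm_sum_le _ _
        _ ≤ _ := by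
            have := sq_sum_le_card_mul_sum_sq (s := Finset.univ) (f := fun u => ‖t n u‖)
            simpa using this
    rw [hsum, norm_mul, norm_pow, Complex.norm_ofNat, mul_pow] at h1
    rw [norm_mul, norm_inv, Complex.norm_natCast, mul_pow, inv_pow, ← div_eq_inv_mul,
      ← div_eq_inv_mul, div_le_div_iff₀ (by positivity) (by positivity)]
    have h2k : (0 : ℝ) < 2 ^ k := by positivity
    refine le_of_mul_le_mul_left ?_ (mul_pos h2k hk')
    nlinarith [mul_le_mul_of_nonneg_left h1 (show (0 : ℝ) ≤ k ^ 2 by positivity)]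
  calc traceFid A ≤ ∑ n, ((2 : ℝ) ^ k * k)⁻¹ * ∑ u, ‖t n u‖ ^ 2 :=
        Finset.sum_le_sum fun n _ => hn n
    _ = _ := by
        rw [← Finset.mul_sum, Finset.sum_comm]
        rfl

/-- A lower bound of the pure state fidelity by a quadratic form. With
`H = Re ∑ₙ (tr Aₙ / k)‾ Aₙ`, the inequality `|t|² ≥ 2 Re (a‾ t) - |a|²` for `t = ⟨φ, Aₙ φ⟩` and
`a = tr Aₙ / k` gives `⟨φ, Λ(|φ⟩⟨φ|) φ⟩ ≥ 2 ⟨φ, H φ⟩ - F_e`; the matrix of the statement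
is `1 - H`. -/
theorem IsSubnormalized.exists_quadraticForm {A : ι → Matrix (Fin k) (Fin k) ℂ} (hk : 0 < k)
    (hA : IsSubnormalized A) : ∃ K : Matrix (Fin k) (Fin k) ℂ, K.IsHermitian ∧
      (∀ φ, sqNorm φ = 1 → 0 ≤ expVal K φ ∧ expVal K φ ≤ 2) ∧
      K.trace.re = k * (1 - traceFid A) ∧
      ∀ φ, sqNorm φ = 1 → 2 * (1 - expVal K φ) - traceFid A ≤ vecFid A φ := by
  let α : ι → ℂ := fun n => (k : ℂ)⁻¹ * (A n).trace
  let B : Matrix (Fin k) (Fin k) ℂ := ∑ n, star (α n) • A n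
  have hkc : (k : ℂ) ≠ 0 := by exact_mod_cast hk.ne'
  have hB : ∀ φ, expVal ((1 / 2 : ℂ) • (B + Bᴴ)) φ =
      ∑ n, (star (α n) * (star φ ⬝ᵥ (A n *ᵥ φ))).re := by
    intro φ
    have h1 : star φ ⬝ᵥ (Bᴴ *ᵥ φ) = star (star φ ⬝ᵥ (B *ᵥ φ)) := by
      rw [← star_mulVec_dotProduct, Matrix.star_dotProduct]
    have h2 : star φ ⬝ᵥ (B *ᵥ φ) = ∑ n, star (α n) * (star φ ⬝ᵥ (A n *ᵥ φ)) := by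
      simp only [B, Matrix.sum_mulVec, Matrix.smul_mulVec, dotProduct_sum, dotProduct_smul,
        smul_eq_mul]
    rw [expVal, Matrix.smul_mulVec, Matrix.add_mulVec, dotProduct_smul, dotProduct_add, h1,
      ← Complex.re_sum, ← h2]
    simp
    ring
  have hK : ∀ φ, sqNorm φ = 1 → expVal (1 - (1 / 2 : ℂ) • (B + Bᴴ)) φ =
      1 - ∑ n, (star (α n) * (star φ ⬝ᵥ (A n *ᵥ φ))).re := by
    intro φ hφ
    rw [← hB, expVal, expVal, Matrix.sub_mulVec, Matrix.one_mulVec, dotProduct_sub,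
      Complex.sub_re, (star_dotProduct_self_eq_one_iff φ).mpr hφ, Complex.one_re]
  have hineq : ∀ z w : ℂ, 2 * (star z * w).re ≤ ‖z‖ ^ 2 + ‖w‖ ^ 2 ∧
      -(‖z‖ ^ 2 + ‖w‖ ^ 2) ≤ 2 * (star z * w).re := by
    intro z w
    rw [Complex.sq_norm, Complex.sq_norm, Complex.normSq_apply, Complex.normSq_apply]
    simp only [RCLike.star_def, Complex.mul_re, Complex.conj_re, Complex.conj_im]
    constructor
    · nlinarith [sq_nonneg (z.re - w.re), sq_nonneg (z.im - w.im)]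
    · nlinarith [sq_nonneg (z.re + w.re), sq_nonneg (z.im + w.im)]
  have hup : ∀ φ, 2 * ∑ n, (star (α n) * (star φ ⬝ᵥ (A n *ᵥ φ))).re ≤
      traceFid A + vecFid A φ := by
    intro φ
    rw [traceFid, vecFid, ← Finset.sum_add_distrib, Finset.mul_sum]
    exact Finset.sum_le_sum fun n _ => (hineq _ _).1
  have hlow : ∀ φ, -(traceFid A + vecFid A φ) ≤
      2 * ∑ n, (star (α n) * (star φ ⬝ᵥ (A n *ᵥ φ))).re := by
    intro φ
    rw [traceFid, vecFid, ← Finset.sum_add_distrib, Finset.mul_sum, ← Finset.sum_neg_distrib]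
    exact Finset.sum_le_sum fun n _ => (hineq _ _).2
  refine ⟨1 - (1 / 2 : ℂ) • (B + Bᴴ), ?_, ?_, ?_, ?_⟩
  · refine Matrix.IsHermitian.sub Matrix.isHermitian_one ?_
    rw [Matrix.IsHermitian, Matrix.conjTranspose_smul, Matrix.conjTranspose_add,
      Matrix.conjTranspose_conjTranspose, add_comm]
    simp
  · intro φ hφ
    rw [hK φ hφ]
    have h1 := hA.traceFid_le_one
    have h2 := hA.vecFid_le_one hφ
    constructor <;> linarith [hup φ, hlow φ]
  · have h1 : B.trace = (k * traceFid A : ℝ) := by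
      have h2 : ∀ n, star (α n) * (A n).trace = ((k * ‖α n‖ ^ 2 : ℝ) : ℂ) := by
        intro n
        have h3 : (A n).trace = k * α n := by
          simp only [α]
          rw [← mul_assoc, mul_inv_cancel₀ hkc, one_mul]
        rw [h3, Complex.ofReal_mul, Complex.ofReal_pow, ← Complex.conj_mul', RCLike.star_def]
        push_cast
        ring
      simp only [B, Matrix.trace_sum, Matrix.trace_smul, smul_eq_mul, h2, traceFid]
      rw [← Complex.ofReal_sum, ← Finset.mul_sum]
    rw [Matrix.trace_sub, Matrix.trace_one, Matrix.trace_smul, Matrix.trace_add,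
      Matrix.trace_conjTranspose, h1, RCLike.star_def, Complex.conj_ofReal, Fintype.card_fin,
      smul_eq_mul]
    simp
    ring
  · intro φ hφ
    rw [hK φ hφ]
    linarith [hup φ]

end Families

/-! ### Gaussian vectors and quadratic forms -/

section Gaussian

/-- The standard Gaussian measure on `ℝ^σ`. -/
noncomputable def stdNormal (σ : Type*) [Fintype σ] : Measure (σ → ℝ) :=
  Measure.pi fun _ => ProbabilityTheory.gaussianReal 0 1

instance (σ : Type*) [Fintype σ] : IsProbabilityMeasure (stdNormal σ) := by
  unfold stdNormal
  infer_instance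

/-- A matrix with orthonormal rows maps the standard Gaussian measure to the standard Gaussian
measure. -/
theorem map_mulVec_stdNormal {ρ σ : Type*} [Fintype ρ] [DecidableEq ρ] [Fintype σ]
    {T : Matrix ρ σ ℝ} (hT : T * Tᵀ = 1) : (stdNormal σ).map (fun g => T *ᵥ g) = stdNormal ρ := by
  have hm : Measurable fun g : σ → ℝ => T *ᵥ g :=
    (Continuous.matrix_mulVec continuous_const continuous_id).measurable
  have : IsProbabilityMeasure ((stdNormal σ).map (fun g => T *ᵥ g)) :=
    Measure.isProbabilityMeasure_map hm.aemeasurable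
  apply (MeasurableEquiv.toLp 2 (ρ → ℝ)).map_measurableEquiv_injective
  have : IsProbabilityMeasure (((stdNormal σ).map (fun g => T *ᵥ g)).map
      (MeasurableEquiv.toLp 2 (ρ → ℝ))) :=
    Measure.isProbabilityMeasure_map (MeasurableEquiv.measurable _).aemeasurable
  have : IsProbabilityMeasure ((stdNormal ρ).map (MeasurableEquiv.toLp 2 (ρ → ℝ))) :=
    Measure.isProbabilityMeasure_map (MeasurableEquiv.measurable _).aemeasurable
  refine Measure.ext_of_charFun (funext fun t => ?_)
  have hρ : (stdNormal ρ).map (MeasurableEquiv.toLp 2 (ρ → ℝ)) =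
      ProbabilityTheory.stdGaussian (EuclideanSpace ℝ ρ) := ProbabilityTheory.map_pi_eq_stdGaussian
  have hσ : (stdNormal σ).map (WithLp.toLp 2) =
      ProbabilityTheory.stdGaussian (EuclideanSpace ℝ σ) := ProbabilityTheory.map_pi_eq_stdGaussian
  rw [hρ, ProbabilityTheory.charFun_stdGaussian, Measure.map_map (MeasurableEquiv.measurable _) hm,
    charFun_apply, integral_map ((MeasurableEquiv.measurable _).comp hm).aemeasurable
      (Measurable.aestronglyMeasurable (by fun_prop))]
  have hinner : ∀ g : σ → ℝ, inner ℝ (WithLp.toLp 2 (T *ᵥ g)) t =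
      inner ℝ (WithLp.toLp 2 g) (WithLp.toLp 2 (Tᵀ *ᵥ t.ofLp)) := by
    intro g
    simp only [EuclideanSpace.inner_eq_star_dotProduct, star_trivial]
    rw [Matrix.dotProduct_mulVec, ← Matrix.mulVec_transpose]
  have hnorm : ‖(WithLp.toLp 2 (Tᵀ *ᵥ t.ofLp) : EuclideanSpace ℝ σ)‖ = ‖t‖ := by
    rw [← sq_eq_sq₀ (norm_nonneg _) (norm_nonneg _), ← real_inner_self_eq_norm_sq,
      ← real_inner_self_eq_norm_sq, ← hinner, Matrix.mulVec_mulVec, hT, Matrix.one_mulVec]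
  have h2 := ProbabilityTheory.charFun_stdGaussian
    (WithLp.toLp 2 (Tᵀ *ᵥ t.ofLp) : EuclideanSpace ℝ σ)
  rw [← hσ, charFun_apply, integral_map (Measurable.aemeasurable (by fun_prop))
    (Measurable.aestronglyMeasurable (by fun_prop)), hnorm] at h2
  rw [← h2]
  refine integral_congr_ae (ae_of_all _ fun g => ?_)
  simp only [Function.comp_apply, MeasurableEquiv.coe_toLp, hinner]

theorem inv_one_sub_le_exp {x : ℝ} (hx : |x| ≤ 1 / 2) : (1 - x)⁻¹ ≤ Real.exp (x + x ^ 2) := by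
  obtain ⟨h1, h2⟩ := abs_le.mp hx
  rw [inv_le_iff_one_le_mul₀ (by linarith)]
  rcases le_total 0 x with h0 | h0
  · have h3 : 1 + (x + x ^ 2) + (x + x ^ 2) ^ 2 / 2 ≤ Real.exp (x + x ^ 2) :=
      Real.quadratic_le_exp_of_nonneg (by positivity)
    have h4 : 1 ≤ (1 + (x + x ^ 2) + (x + x ^ 2) ^ 2 / 2) * (1 - x) := by
      have h5 : 0 ≤ x ^ 2 * ((1 - x) * (1 + x) ^ 2 / 2 - x) := by
        refine mul_nonneg (sq_nonneg x) ?_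
        nlinarith [mul_nonneg h0 (sub_nonneg.mpr h2), mul_nonneg h0 h0,
          mul_nonneg (mul_nonneg h0 h0) (sub_nonneg.mpr h2)]
      nlinarith
    exact h4.trans (by gcongr; linarith)
  · have h3 : x + x ^ 2 + 1 ≤ Real.exp (x + x ^ 2) := Real.add_one_le_exp _
    have h4 : 1 ≤ (x + x ^ 2 + 1) * (1 - x) := by
      nlinarith [mul_nonneg (sq_nonneg x) (neg_nonneg.mpr h0)]
    exact h4.trans (by gcongr; linarith)

theorem gaussian_exp_sq {θ : ℝ} (hθ : |θ| ≤ 1 / 4) :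
    Integrable (fun x => Real.exp (θ * x ^ 2)) (ProbabilityTheory.gaussianReal 0 1) ∧
      ∫ x, Real.exp (θ * x ^ 2) ∂ProbabilityTheory.gaussianReal 0 1 ≤
        Real.exp (θ + 2 * θ ^ 2) := by
  obtain ⟨h1, h2⟩ := abs_le.mp hθ
  have hpdf : ∀ x : ℝ, ProbabilityTheory.gaussianPDFReal 0 1 x • Real.exp (θ * x ^ 2) =
      (√(2 * Real.pi))⁻¹ * Real.exp (-(1 / 2 - θ) * x ^ 2) := by
    intro x
    rw [ProbabilityTheory.gaussianPDFReal, smul_eq_mul, mul_assoc, ← Real.exp_add]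
    simp only [NNReal.coe_one, mul_one, sub_zero]
    congr 2
    ring
  have hpos : 0 < 1 / 2 - θ := by linarith
  constructor
  · rw [ProbabilityTheory.gaussianReal_of_var_ne_zero _ one_ne_zero,
      integrable_withDensity_iff_integrable_smul' (ProbabilityTheory.measurable_gaussianPDF _ _)
        (ae_of_all _ fun _ => ProbabilityTheory.gaussianPDF_lt_top)]
    simp only [ProbabilityTheory.toReal_gaussianPDF, hpdf]
    exact (integrable_exp_neg_mul_sq hpos).const_mul _
  · rw [ProbabilityTheory.integral_gaussianReal_eq_integral_smul one_ne_zero]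
    simp only [hpdf]
    rw [integral_const_mul, integral_gaussian]
    have h3 : (√(2 * Real.pi))⁻¹ * √(Real.pi / (1 / 2 - θ)) = √((1 - 2 * θ)⁻¹) := by
      rw [← Real.sqrt_inv, ← Real.sqrt_mul (by positivity)]
      congr 1
      have : (1 - 2 * θ) ≠ 0 := by linarith
      have : (1 / 2 - θ) ≠ 0 := hpos.ne'
      field_simp
    rw [h3, Real.sqrt_le_left (Real.exp_pos _).le, ← Real.exp_nat_mul]
    refine (inv_one_sub_le_exp (x := 2 * θ) ?_).trans_eq ?_
    · rw [abs_mul, abs_two]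
      linarith
    · congr 1
      push_cast
      ring

/-- An exponential Markov inequality for diagonal quadratic forms of a Gaussian vector. -/
theorem stdNormal_quadratic_tail {ρ : Type*} [Fintype ρ] {θ : ρ → ℝ} (hθ : ∀ r, |θ r| ≤ 1 / 4)
    (c : ℝ) : stdNormal ρ {x | c ≤ ∑ r, θ r * x r ^ 2} ≤
      ENNReal.ofReal (Real.exp (∑ r, (θ r + 2 * θ r ^ 2) - c)) := by
  have hexp : ∀ x : ρ → ℝ, Real.exp (∑ r, θ r * x r ^ 2) = ∏ r, Real.exp (θ r * x r ^ 2) :=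
    fun x => Real.exp_sum _ _
  have hint : Integrable (fun x : ρ → ℝ => Real.exp (∑ r, θ r * x r ^ 2)) (stdNormal ρ) := by
    simp only [hexp]
    exact Integrable.fintype_prod fun r => (gaussian_exp_sq (hθ r)).1
  have hle : ∫ x, Real.exp (∑ r, θ r * x r ^ 2) ∂stdNormal ρ ≤
      Real.exp (∑ r, (θ r + 2 * θ r ^ 2)) := by
    simp only [hexp, stdNormal]
    rw [integral_fintype_prod_eq_prod (fun r (y : ℝ) => Real.exp (θ r * y ^ 2)), Real.exp_sum]
    exact Finset.prod_le_prod (fun r _ => integral_nonneg fun _ => (Real.exp_pos _).le)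
      fun r _ => (gaussian_exp_sq (hθ r)).2
  have hmarkov := mul_meas_ge_le_integral_of_nonneg
    (ae_of_all (stdNormal ρ) fun x => (Real.exp_pos (∑ r, θ r * x r ^ 2)).le) hint (Real.exp c)
  simp only [Real.exp_le_exp] at hmarkov
  have hreal : (stdNormal ρ).real {x | c ≤ ∑ r, θ r * x r ^ 2} ≤
      Real.exp (∑ r, (θ r + 2 * θ r ^ 2) - c) := by
    rw [Real.exp_sub, le_div_iff₀' (Real.exp_pos _)]
    exact hmarkov.trans hle
  rw [← ofReal_measureReal]
  exact ENNReal.ofReal_le_ofReal hreal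

/-- The complex vector with real parts `g (e, false)` and imaginary parts `g (e, true)`. -/
noncomputable def toComplexVec {q : Type*} (g : q × Bool → ℝ) : q → ℂ :=
  fun e => ⟨g (e, false), g (e, true)⟩

/-- The tail bound for a quadratic form that is diagonal in orthonormal coordinates of a complex
Gaussian vector. -/
theorem stdNormal_complex_tail {p q : Type*} [Fintype p] [DecidableEq p] [Fintype q]
    {α : Matrix p q ℂ} (hα : α * αᴴ = 1) {θ : p → ℝ} (hθ : ∀ i, |θ i| ≤ 1 / 4) (c : ℝ) :
    stdNormal (q × Bool) {g | c ≤ ∑ i, θ i * ‖(α *ᵥ toComplexVec g) i‖ ^ 2} ≤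
      ENNReal.ofReal (Real.exp (∑ i, (2 * θ i + 4 * θ i ^ 2) - c)) := by
  let T : Matrix (p × Bool) (q × Bool) ℝ := Matrix.of fun r e =>
    match r.2, e.2 with
    | false, false => (α r.1 e.1).re
    | false, true => -(α r.1 e.1).im
    | true, false => (α r.1 e.1).im
    | true, true => (α r.1 e.1).re
  have hre : ∀ i i', ∑ e, ((α i e).re * (α i' e).re + (α i e).im * (α i' e).im) =
      if i = i' then 1 else 0 := by
    intro i i'
    have := congrArg Complex.re (congrFun (congrFun hα i) i')
    simp only [Matrix.mul_apply, Matrix.conjTranspose_apply, Complex.re_sum, Complex.mul_re,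
      RCLike.star_def, Complex.conj_re, Complex.conj_im, Matrix.one_apply] at this
    rw [apply_ite Complex.re, Complex.one_re, Complex.zero_re] at this
    rw [← this]
    exact Finset.sum_congr rfl fun e _ => by ring
  have him : ∀ i i', ∑ e, ((α i e).im * (α i' e).re - (α i e).re * (α i' e).im) = 0 := by
    intro i i'
    have := congrArg Complex.im (congrFun (congrFun hα i) i')
    simp only [Matrix.mul_apply, Matrix.conjTranspose_apply, Complex.im_sum, Complex.mul_im,
      RCLike.star_def, Complex.conj_re, Complex.conj_im, Matrix.one_apply] at this
    rw [apply_ite Complex.im, Complex.one_im, Complex.zero_im, ite_self] at this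
    rw [← this]
    exact Finset.sum_congr rfl fun e _ => by ring
  have hT : T * Tᵀ = 1 := by
    ext ⟨i, s⟩ ⟨i', s'⟩
    simp only [Matrix.mul_apply, Matrix.transpose_apply, Fintype.sum_prod_type, Fintype.sum_bool,
      T, Matrix.of_apply, Matrix.one_apply, Prod.mk.injEq]
    rcases s with _ | _ <;> rcases s' with _ | _ <;> simp only [and_true, reduceCtorEq, and_false,
      if_false]
    · rw [← hre]
      exact Finset.sum_congr rfl fun e _ => by ring
    · rw [← neg_eq_zero.mpr (him i i'), ← Finset.sum_neg_distrib]
      refine Finset.sum_congr rfl fun e _ => by ring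
    · rw [← him i i']
      exact Finset.sum_congr rfl fun e _ => by ring
    · rw [← hre]
  have hcoord : ∀ (g : q × Bool → ℝ) (i : p), ‖(α *ᵥ toComplexVec g) i‖ ^ 2 =
      (T *ᵥ g) (i, false) ^ 2 + (T *ᵥ g) (i, true) ^ 2 := by
    intro g i
    have h1 : ((α *ᵥ toComplexVec g) i).re = (T *ᵥ g) (i, false) := by
      simp only [Matrix.mulVec, dotProduct, Complex.re_sum, Complex.mul_re, toComplexVec,
        Fintype.sum_prod_type, Fintype.sum_bool, T, Matrix.of_apply]
      exact Finset.sum_congr rfl fun e _ => by ring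
    have h2 : ((α *ᵥ toComplexVec g) i).im = (T *ᵥ g) (i, true) := by
      simp only [Matrix.mulVec, dotProduct, Complex.im_sum, Complex.mul_im, toComplexVec,
        Fintype.sum_prod_type, Fintype.sum_bool, T, Matrix.of_apply]
    rw [Complex.sq_norm, Complex.normSq_apply, h1, h2]
    ring
  have hset : {g : q × Bool → ℝ | c ≤ ∑ i, θ i * ‖(α *ᵥ toComplexVec g) i‖ ^ 2} =
      (fun g => T *ᵥ g) ⁻¹' {x | c ≤ ∑ r : p × Bool, θ r.1 * x r ^ 2} := by
    ext g
    simp only [Set.mem_ofPred_eq, Set.mem_preimage, hcoord, Fintype.sum_prod_type, Fintype.sum_bool]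
    rw [Finset.sum_congr rfl fun i _ => show θ i * ((T *ᵥ g) (i, false) ^ 2 +
      (T *ᵥ g) (i, true) ^ 2) = θ i * (T *ᵥ g) (i, true) ^ 2 + θ i * (T *ᵥ g) (i, false) ^ 2 by ring]
  have hmeas : MeasurableSet {x : p × Bool → ℝ | c ≤ ∑ r : p × Bool, θ r.1 * x r ^ 2} :=
    measurableSet_le measurable_const (by fun_prop)
  have hm : Measurable fun g : q × Bool → ℝ => T *ᵥ g :=
    (Continuous.matrix_mulVec continuous_const continuous_id).measurable
  rw [hset, ← Measure.map_apply hm hmeas, map_mulVec_stdNormal hT]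
  refine (stdNormal_quadratic_tail (θ := fun r : p × Bool => θ r.1) (fun r => hθ r.1) c).trans_eq ?_
  simp only [Fintype.sum_prod_type, Fintype.sum_bool]
  rw [Finset.sum_congr rfl fun i _ => show θ i + 2 * θ i ^ 2 + (θ i + 2 * θ i ^ 2) =
    2 * θ i + 4 * θ i ^ 2 by ring]

end Gaussian

/-! ### Subspaces on which many quadratic forms are almost constant -/

section Subspace

/-- A net of the unit sphere of `ℂ^m`, of resolution `1 / n` in each real coordinate. -/
theorem exists_sphere_net (m : ℕ) {n : ℕ} (hn : 0 < n) :
    ∃ T : Finset (Fin m → ℂ), T.card ≤ (2 * n + 1) ^ (2 * m) ∧ (∀ u ∈ T, sqNorm u = 1) ∧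
      ∀ u, sqNorm u = 1 → ∃ u' ∈ T, sqNorm (u - u') ≤ 2 * m / (n : ℝ) ^ 2 := by
  classical
  have hn' : (0 : ℝ) < n := by exact_mod_cast hn
  let S : Set (Fin m → ℂ) := {u | sqNorm u = 1}
  let coord : (Fin m → ℂ) → Fin m × Bool → ℝ := fun u e => if e.2 then (u e.1).im else (u e.1).re
  have hcoord : ∀ u ∈ S, ∀ e, |coord u e| ≤ 1 := by
    intro u hu e
    have h1 : ‖u e.1‖ ^ 2 ≤ 1 := by
      rw [← show sqNorm u = 1 from hu]
      exact Finset.single_le_sum (f := fun x => ‖u x‖ ^ 2) (fun _ _ => by positivity)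
        (Finset.mem_univ e.1)
    have h2 : ‖u e.1‖ ≤ 1 := by
      nlinarith [norm_nonneg (u e.1)]
    rcases e with ⟨e, _ | _⟩
    · exact (Complex.abs_re_le_norm _).trans h2
    · exact (Complex.abs_im_le_norm _).trans h2
  -- Unit vectors are sorted into cells of a grid of width `1 / n`; the net has one point of each
  -- cell that meets the sphere.
  let cell : (Fin m → ℂ) → Fin m × Bool → Fin (2 * n + 1) :=
    fun u e => Fin.ofNat _ ⌊n * (1 + coord u e)⌋₊
  have hcell : ∀ u ∈ S, ∀ e, (cell u e : ℕ) = ⌊n * (1 + coord u e)⌋₊ := by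
    intro u hu e
    simp only [cell, Fin.val_ofNat]
    refine Nat.mod_eq_of_lt (Nat.lt_succ_of_le (Nat.floor_le_of_le ?_))
    have := (abs_le.mp (hcoord u hu e)).2
    push_cast
    nlinarith
  let rep := Function.invFunOn cell S
  refine ⟨(Finset.univ.filter fun c => ∃ u ∈ S, cell u = c).image rep, ?_, ?_, ?_⟩
  · refine Finset.card_image_le.trans ((Finset.card_le_univ _).trans_eq ?_)
    simp [mul_comm]
  · intro u hu
    obtain ⟨c, hc, rfl⟩ := Finset.mem_image.mp hu
    exact Function.invFunOn_mem (Finset.mem_filter.mp hc).2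
  · intro u hu
    have hex : ∃ v ∈ S, cell v = cell u := ⟨u, hu, rfl⟩
    refine ⟨rep (cell u), Finset.mem_image_of_mem _ (Finset.mem_filter.mpr
      ⟨Finset.mem_univ _, hex⟩), ?_⟩
    have hmem : rep (cell u) ∈ S := Function.invFunOn_mem hex
    have heq : cell (rep (cell u)) = cell u := Function.invFunOn_eq hex
    set v := rep (cell u)
    have hdiff : ∀ e, (coord u e - coord v e) ^ 2 ≤ 1 / (n : ℝ) ^ 2 := by
      intro e
      have h1 : ⌊n * (1 + coord u e)⌋₊ = ⌊n * (1 + coord v e)⌋₊ := by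
        rw [← hcell u hu, ← hcell v hmem, heq]
      have h2 : ∀ w ∈ S, 0 ≤ n * (1 + coord w e) := fun w hw =>
        mul_nonneg hn'.le (by linarith [(abs_le.mp (hcoord w hw e)).1])
      have h3 := Nat.floor_le (h2 u hu)
      have h4 := Nat.lt_floor_add_one ((n : ℝ) * (1 + coord u e))
      have h5 := Nat.floor_le (h2 v hmem)
      have h6 := Nat.lt_floor_add_one ((n : ℝ) * (1 + coord v e))
      rw [h1] at h3 h4
      rw [le_div_iff₀ (by positivity), ← mul_pow, sq_le_one_iff_abs_le_one, abs_le]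
      constructor <;> nlinarith
    have hsum : ∀ x, ‖(u - v) x‖ ^ 2 ≤ 2 / (n : ℝ) ^ 2 := by
      intro x
      have h1 := hdiff (x, false)
      have h2 := hdiff (x, true)
      simp only [coord, Bool.false_eq_true, if_false, if_true] at h1 h2
      rw [Complex.sq_norm, Complex.normSq_apply, Pi.sub_apply, Complex.sub_re, Complex.sub_im,
        show (2 : ℝ) / (n : ℝ) ^ 2 = 1 / (n : ℝ) ^ 2 + 1 / (n : ℝ) ^ 2 by ring]
      nlinarith
    calc sqNorm (u - v) ≤ ∑ _x : Fin m, 2 / (n : ℝ) ^ 2 := Finset.sum_le_sum fun x _ => hsum x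
      _ = 2 * m / (n : ℝ) ^ 2 := by
          rw [Finset.sum_const, Finset.card_univ, Fintype.card_fin, nsmul_eq_mul]
          ring

theorem sqNorm_mulVec_le {f g : Type*} [Fintype f] [Fintype g] (G : Matrix g f ℂ) (v : f → ℂ) :
    sqNorm (G *ᵥ v) ≤ (∑ x, ∑ j, ‖G x j‖ ^ 2) * sqNorm v := by
  rw [Finset.sum_mul]
  refine Finset.sum_le_sum fun x _ => ?_
  calc ‖(G *ᵥ v) x‖ ^ 2 ≤ (∑ j, ‖G x j‖ * ‖v j‖) ^ 2 := by
        gcongr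
        refine (norm_sum_le _ _).trans_eq (Finset.sum_congr rfl fun j _ => norm_mul _ _)
    _ ≤ _ := Finset.sum_mul_sq_le_sq_mul_sq _ _ _

/-- A Hermitian form is diagonal in the coordinates of an orthonormal eigenbasis. -/
theorem expVal_eq_sum_eigenvalues {k : ℕ} {K : Matrix (Fin k) (Fin k) ℂ} (hK : K.IsHermitian)
    (y : Fin k → ℂ) : expVal K y =
      ∑ i, hK.eigenvalues i * ‖((hK.eigenvectorUnitary.1)ᴴ *ᵥ y) i‖ ^ 2 := by
  have h : star y ⬝ᵥ (K *ᵥ y) =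
      ((∑ i, hK.eigenvalues i * ‖((hK.eigenvectorUnitary.1)ᴴ *ᵥ y) i‖ ^ 2 : ℝ) : ℂ) := by
    have h1 : ∀ i, ((‖((hK.eigenvectorUnitary.1)ᴴ *ᵥ y) i‖ ^ 2 : ℝ) : ℂ) =
        ∑ x, ∑ x', star (y x) * hK.eigenvectorUnitary.1 x i *
          (star (hK.eigenvectorUnitary.1 x' i) * y x') := by
      intro i
      rw [Complex.ofReal_pow, ← Complex.conj_mul', ← RCLike.star_def]
      simp only [Matrix.mulVec, dotProduct, star_sum, Finset.sum_mul_sum, star_mul',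
        Matrix.conjTranspose_apply, star_star]
      exact Finset.sum_congr rfl fun x _ => Finset.sum_congr rfl fun x' _ => by ring
    simp only [Complex.ofReal_sum, Complex.ofReal_mul, h1, Finset.mul_sum]
    rw [Finset.sum_comm]
    simp only [dotProduct, Matrix.mulVec, Pi.star_apply, Finset.mul_sum]
    refine Finset.sum_congr rfl fun x _ => ?_
    rw [Finset.sum_comm]
    refine Finset.sum_congr rfl fun x' _ => ?_
    rw [hK.apply_eq_sum x x', Finset.sum_mul, Finset.mul_sum]
    exact Finset.sum_congr rfl fun i _ => by ring
  rw [expVal, h, Complex.ofReal_re]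

theorem eigenvectorUnitary_isometry {k : ℕ} {K : Matrix (Fin k) (Fin k) ℂ}
    (hK : K.IsHermitian) :
    (hK.eigenvectorUnitary.1)ᴴ * hK.eigenvectorUnitary.1 = 1 ∧
      ((hK.eigenvectorUnitary.1)ᴴ)ᴴ * (hK.eigenvectorUnitary.1)ᴴ = 1 := by
  rw [Matrix.conjTranspose_conjTranspose]
  exact ⟨Unitary.coe_star_mul_self _, Unitary.coe_mul_star_self _⟩

/-- The eigenvalues of a Hermitian matrix are values of its form at unit vectors. -/
theorem eigenvalues_eq_expVal {k : ℕ} {K : Matrix (Fin k) (Fin k) ℂ} (hK : K.IsHermitian)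
    (i : Fin k) : ∃ φ, sqNorm φ = 1 ∧ expVal K φ = hK.eigenvalues i := by
  have hU := eigenvectorUnitary_isometry hK
  have h1 : ∑ x : Fin k, ‖(Pi.single i (1 : ℂ) : Fin k → ℂ) x‖ ^ 2 = 1 := by
    rw [Finset.sum_eq_single i]
    · simp
    · intro z _ hz
      simp [hz]
    · simp
  refine ⟨hK.eigenvectorUnitary.1 *ᵥ Pi.single i 1, ?_, ?_⟩
  · rw [sqNorm_mulVec_of_isometry hU.1]
    exact h1
  · rw [expVal_eq_sum_eigenvalues hK, Matrix.mulVec_mulVec, hU.1, Matrix.one_mulVec,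
      Finset.sum_eq_single i]
    · simp
    · intro z _ hz
      simp [hz]
    · simp

/-- If a quadratic form `∑ μᵢ |zᵢ|²` with `|μᵢ| ≤ 3` is at most `-c` at the image of a net point,
it is negative at the image of every vector near that point. -/
theorem quadratic_lt_of_near {p : Type*} [Fintype p] {μ : p → ℝ} (hμ : ∀ i, |μ i| ≤ 3)
    {z z' : p → ℂ} {F ρ c : ℝ} (hρ : 0 < ρ) (hz : sqNorm z ≤ F) (hz' : sqNorm z' ≤ F)
    (hd : sqNorm (z - z') ≤ F * ρ ^ 2) (hc : ∑ i, μ i * ‖z' i‖ ^ 2 < -c)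
    (hF : 15 / 2 * ρ * F ≤ c) : ∑ i, μ i * ‖z i‖ ^ 2 < 0 := by
  have hterm : ∀ i, μ i * ‖z i‖ ^ 2 - μ i * ‖z' i‖ ^ 2 ≤
      3 * (‖(z - z') i‖ ^ 2 / (2 * ρ) + ρ * (‖z i‖ ^ 2 + ‖z' i‖ ^ 2)) := by
    intro i
    -- `| |z|² - |z'|² | ≤ |z - z'| (|z| + |z'|)`, and the arithmetic-geometric mean inequality
    -- with weight `ρ` separates the two factors.
    have h1 : |‖z i‖ ^ 2 - ‖z' i‖ ^ 2| ≤
        ‖(z - z') i‖ ^ 2 / (2 * ρ) + ρ * (‖z i‖ ^ 2 + ‖z' i‖ ^ 2) := by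
      have h2 : |‖z i‖ - ‖z' i‖| ≤ ‖(z - z') i‖ := abs_norm_sub_norm_le _ _
      set d := ‖(z - z') i‖
      set x := ‖z i‖ with hx
      set y := ‖z' i‖ with hy
      have hx0 : 0 ≤ x := norm_nonneg _
      have hy0 : 0 ≤ y := norm_nonneg _
      have h3 : |x ^ 2 - y ^ 2| ≤ d * (x + y) := by
        rw [sq_sub_sq, abs_mul, abs_of_nonneg (add_nonneg hx0 hy0), mul_comm]
        gcongr
      refine h3.trans ?_
      rw [div_add' _ _ _ (by positivity), le_div_iff₀ (by positivity)]
      nlinarith [sq_nonneg (d - ρ * (x + y)), sq_nonneg (ρ * (x - y))]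
    calc μ i * ‖z i‖ ^ 2 - μ i * ‖z' i‖ ^ 2 = μ i * (‖z i‖ ^ 2 - ‖z' i‖ ^ 2) := by ring
      _ ≤ |μ i| * |‖z i‖ ^ 2 - ‖z' i‖ ^ 2| := by
          rw [← abs_mul]
          exact le_abs_self _
      _ ≤ _ := mul_le_mul (hμ i) h1 (abs_nonneg _) (by norm_num)
  have hsum : ∑ i, μ i * ‖z i‖ ^ 2 - ∑ i, μ i * ‖z' i‖ ^ 2 ≤
      3 * (sqNorm (z - z') / (2 * ρ) + ρ * (sqNorm z + sqNorm z')) := by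
    rw [← Finset.sum_sub_distrib]
    refine (Finset.sum_le_sum fun i _ => hterm i).trans_eq ?_
    simp only [sqNorm, Finset.mul_sum, Finset.sum_div, Finset.sum_add_distrib, mul_add]
  have h1 : sqNorm (z - z') / (2 * ρ) ≤ F * ρ / 2 := by
    rw [div_le_iff₀ (by positivity)]
    nlinarith
  have h2 : ρ * (sqNorm z + sqNorm z') ≤ ρ * (F + F) := by gcongr
  nlinarith

/-- An injective matrix `G` has the same range as some isometry. -/
theorem exists_isometry_of_injective {k m : ℕ} {G : Matrix (Fin k) (Fin m) ℂ}
    (hG : ∀ u, G *ᵥ u = 0 → u = 0) :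
    ∃ W : Matrix (Fin k) (Fin m) ℂ, Wᴴ * W = 1 ∧ ∀ u, ∃ v, W *ᵥ u = G *ᵥ v := by
  let L : (Fin m → ℂ) →ₗ[ℂ] EuclideanSpace ℂ (Fin k) :=
    (WithLp.linearEquiv 2 ℂ (Fin k → ℂ)).symm.toLinearMap ∘ₗ G.mulVecLin
  have hL : Function.Injective L := by
    rw [← LinearMap.ker_eq_bot, LinearMap.ker_eq_bot']
    intro u hu
    exact hG u (by simpa [L] using hu)
  have hrank : Module.finrank ℂ (LinearMap.range L) = m := by
    rw [LinearMap.finrank_range_of_inj hL, Module.finrank_fin_fun]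
  let b := (stdOrthonormalBasis ℂ (LinearMap.range L)).reindex (finCongr hrank)
  have hb : ∀ i j,
      inner ℂ (b i : EuclideanSpace ℂ (Fin k)) (b j) = if i = j then (1 : ℂ) else 0 := by
    intro i j
    rw [← Submodule.coe_inner]
    exact orthonormal_iff_ite.mp b.orthonormal i j
  refine ⟨Matrix.of fun x j => (b j : EuclideanSpace ℂ (Fin k)).ofLp x, ?_, fun u => ?_⟩
  · ext i j
    rw [Matrix.one_apply, ← hb i j, EuclideanSpace.inner_eq_star_dotProduct, dotProduct_comm]
    rfl
  · obtain ⟨v, hv⟩ := (∑ j, u j • b j).2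
    refine ⟨v, funext fun x => ?_⟩
    have := congrArg (fun w : EuclideanSpace ℂ (Fin k) => w.ofLp x) hv
    simp only [L, LinearMap.comp_apply, Submodule.coe_sum, Submodule.coe_smul] at this
    simp only [Matrix.mulVec, dotProduct, Matrix.of_apply]
    simp [Matrix.mulVec, dotProduct] at this
    rw [this]
    exact Finset.sum_congr rfl fun j _ => mul_comm _ _

end Subspace

section RandomSubspace

variable {k m : ℕ}

/-- The complex `k × m` matrix with the entries of a real vector as real and imaginary parts. -/
noncomputable def toComplexMatrix (g : (Fin k × Fin m) × Bool → ℝ) : Matrix (Fin k) (Fin m) ℂ :=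
  Matrix.of fun x j => toComplexVec g (x, j)

/-- The form `⟨y, K y⟩ - c ‖y‖²` in the coordinates of an eigenbasis of `K`. -/
theorem expVal_sub_eq_sum {K : Matrix (Fin k) (Fin k) ℂ} (hK : K.IsHermitian) (c : ℝ)
    (y : Fin k → ℂ) : expVal K y - c * sqNorm y =
      ∑ i, (hK.eigenvalues i - c) * ‖((hK.eigenvectorUnitary.1)ᴴ *ᵥ y) i‖ ^ 2 := by
  rw [expVal_eq_sum_eigenvalues hK, ← sqNorm_mulVec_of_isometry (eigenvectorUnitary_isometry hK).2,
    sqNorm, Finset.mul_sum, ← Finset.sum_sub_distrib]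
  exact Finset.sum_congr rfl fun i _ => by ring

theorem abs_eigenvalues_sub_le (hk : 0 < k) {K : Matrix (Fin k) (Fin k) ℂ} (hK : K.IsHermitian)
    (hK2 : ∀ φ, sqNorm φ = 1 → 0 ≤ expVal K φ ∧ expVal K φ ≤ 2) {δ : ℝ} (hδ : 0 < δ) (hδ1 : δ ≤ 1) :
    (∀ i, |hK.eigenvalues i - (K.trace.re / k + δ)| ≤ 3) ∧
      ∑ i, (hK.eigenvalues i - (K.trace.re / k + δ)) = -(δ * k) := by
  have hk' : (0 : ℝ) < k := by exact_mod_cast hk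
  have hlam : ∀ i, 0 ≤ hK.eigenvalues i ∧ hK.eigenvalues i ≤ 2 := by
    intro i
    obtain ⟨φ, h1, h2⟩ := eigenvalues_eq_expVal hK i
    rw [← h2]
    exact hK2 φ h1
  have htr : K.trace.re = ∑ i, hK.eigenvalues i := by
    rw [hK.trace_eq_sum_eigenvalues, Complex.re_sum]
    exact Finset.sum_congr rfl fun i _ => Complex.ofReal_re _
  have h0 : 0 ≤ K.trace.re / k := by
    rw [htr]
    exact div_nonneg (Finset.sum_nonneg fun i _ => (hlam i).1) hk'.le
  have h2 : K.trace.re / k ≤ 2 := by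
    rw [div_le_iff₀ hk', htr]
    calc ∑ i, hK.eigenvalues i ≤ ∑ _i : Fin k, (2 : ℝ) := Finset.sum_le_sum fun i _ => (hlam i).2
      _ = 2 * k := by simp [mul_comm]
  refine ⟨fun i => abs_le.mpr ⟨?_, ?_⟩, ?_⟩
  · linarith [(hlam i).1]
  · linarith [(hlam i).2]
  · rw [Finset.sum_sub_distrib, ← htr, Finset.sum_const, Finset.card_univ, Fintype.card_fin,
      nsmul_eq_mul]
    field_simp
    ring

/-- For a Gaussian matrix `G` and a fixed unit vector `u`, the vector `G u` is Gaussian, so that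
`⟨G u, K G u⟩` exceeds `(tr K / k + δ) ‖G u‖²` only with exponentially small probability. -/
theorem stdNormal_expVal_tail (hk : 0 < k) {K : Matrix (Fin k) (Fin k) ℂ} (hK : K.IsHermitian)
    (hK2 : ∀ φ, sqNorm φ = 1 → 0 ≤ expVal K φ ∧ expVal K φ ≤ 2) {δ : ℝ} (hδ : 0 < δ) (hδ1 : δ ≤ 1)
    {u : Fin m → ℂ} (hu : sqNorm u = 1) :
    stdNormal ((Fin k × Fin m) × Bool) {g | -(δ * k) ≤ expVal K (toComplexMatrix g *ᵥ u) -
      (K.trace.re / k + δ) * sqNorm (toComplexMatrix g *ᵥ u)} ≤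
      ENNReal.ofReal (Real.exp (-(δ ^ 2 * k / 144))) := by
  set c := K.trace.re / k + δ
  obtain ⟨hμ, hμs⟩ := abs_eigenvalues_sub_le hk hK hK2 hδ hδ1
  set U := hK.eigenvectorUnitary.1 with hU
  let α : Matrix (Fin k) (Fin k × Fin m) ℂ := Matrix.of fun i e => star (U e.1 i) * u e.2
  have hαv : ∀ g, α *ᵥ toComplexVec g = Uᴴ *ᵥ (toComplexMatrix g *ᵥ u) := by
    intro g
    ext i
    simp only [Matrix.mulVec, dotProduct, α, Matrix.of_apply, Fintype.sum_prod_type,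
      Matrix.conjTranspose_apply, toComplexMatrix, Finset.mul_sum]
    exact Finset.sum_congr rfl fun x _ => Finset.sum_congr rfl fun j _ => by ring
  have hα : α * αᴴ = 1 := by
    rw [← (eigenvectorUnitary_isometry hK).1]
    ext i i'
    have hu' : ∑ j, u j * star (u j) = 1 := by
      rw [← (star_dotProduct_self_eq_one_iff u).mpr hu, dotProduct_comm]
      rfl
    simp only [Matrix.mul_apply, Matrix.conjTranspose_apply, α, Matrix.of_apply,
      Fintype.sum_prod_type, star_mul', star_star]
    refine Finset.sum_congr rfl fun x _ => ?_
    rw [← hU, ← mul_one (star (U x i) * U x i'), ← hu', Finset.mul_sum]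
    exact Finset.sum_congr rfl fun j _ => by ring
  -- The parameter `δ / 72` minimizes the exponent `- s δ k + 36 s² k`.
  have hθ : ∀ i, |δ / 72 * (hK.eigenvalues i - c)| ≤ 1 / 4 := by
    intro i
    rw [abs_mul, abs_of_pos (by positivity : 0 < δ / 72)]
    nlinarith [hμ i, abs_nonneg (hK.eigenvalues i - c)]
  have htail := stdNormal_complex_tail hα hθ (-(δ / 72 * (δ * k)))
  have hset : {g | -(δ * k) ≤ expVal K (toComplexMatrix g *ᵥ u) -
      c * sqNorm (toComplexMatrix g *ᵥ u)} = {g | -(δ / 72 * (δ * k)) ≤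
        ∑ i, δ / 72 * (hK.eigenvalues i - c) * ‖(α *ᵥ toComplexVec g) i‖ ^ 2} := by
    ext g
    simp only [Set.mem_ofPred_eq, expVal_sub_eq_sum hK c, hαv, mul_assoc, ← Finset.mul_sum]
    rw [show -(δ / 72 * (δ * k)) = δ / 72 * -(δ * k) by ring,
      mul_le_mul_iff_right₀ (by positivity : 0 < δ / 72)]
  rw [hset]
  refine htail.trans (ENNReal.ofReal_le_ofReal (Real.exp_le_exp.mpr ?_))
  have h1 : ∑ i, (2 * (δ / 72 * (hK.eigenvalues i - c)) +
      4 * (δ / 72 * (hK.eigenvalues i - c)) ^ 2) ≤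
      ∑ i, (δ / 36 * (hK.eigenvalues i - c) + δ ^ 2 / 144) := by
    refine Finset.sum_le_sum fun i _ => ?_
    have h2 : (hK.eigenvalues i - c) ^ 2 ≤ 3 ^ 2 := sq_le_sq' (abs_le.mp (hμ i)).1 (abs_le.mp (hμ i)).2
    nlinarith [mul_le_mul_of_nonneg_left h2 (sq_nonneg δ)]
  have h2 : ∑ i, (δ / 36 * (hK.eigenvalues i - c) + δ ^ 2 / 144) =
      δ / 36 * -(δ * k) + k * (δ ^ 2 / 144) := by
    rw [Finset.sum_add_distrib, ← Finset.mul_sum, hμs, Finset.sum_const, Finset.card_univ,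
      Fintype.card_fin, nsmul_eq_mul]
  linarith

/-- The Hilbert-Schmidt norm of a Gaussian matrix is not much larger than expected. -/
theorem stdNormal_frobenius_tail (hk : 0 < k) (hm : 0 < m) :
    stdNormal ((Fin k × Fin m) × Bool)
      {g | 8 * (k * m : ℝ) ≤ ∑ x, ∑ j, ‖(toComplexMatrix g : Matrix (Fin k) (Fin m) ℂ) x j‖ ^ 2} ≤
      ENNReal.ofReal (1 / 2) := by
  have h1 : (1 : ℝ) ≤ k * m := by exact_mod_cast Nat.mul_pos hk hm
  have htail := stdNormal_complex_tail 
    (α := (1 : Matrix (Fin k × Fin m) (Fin k × Fin m) ℂ)) (by simp)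
    (θ := fun _ => 1 / 4) (fun _ => by norm_num) (2 * (k * m : ℝ))
  have hset : {g | 8 * (k * m : ℝ) ≤
      ∑ x, ∑ j, ‖(toComplexMatrix g : Matrix (Fin k) (Fin m) ℂ) x j‖ ^ 2} =
      {g : (Fin k × Fin m) × Bool → ℝ | 2 * (k * m : ℝ) ≤ ∑ i, 1 / 4 *
        ‖((1 : Matrix (Fin k × Fin m) (Fin k × Fin m) ℂ) *ᵥ toComplexVec g) i‖ ^ 2} := by
    ext g
    simp only [Set.mem_ofPred_eq, Matrix.one_mulVec, ← Finset.mul_sum, toComplexMatrix,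
      Matrix.of_apply, Fintype.sum_prod_type]
    constructor <;> intro h <;> linarith
  rw [hset]
  refine htail.trans (ENNReal.ofReal_le_ofReal ?_)
  simp only [Finset.sum_const, Finset.card_univ, Fintype.card_prod, Fintype.card_fin,
    nsmul_eq_mul, Nat.cast_mul]
  have h2 : (k * m : ℝ) * (2 * (1 / 4) + 4 * (1 / 4) ^ 2) - 2 * (k * m) ≤ -1 := by nlinarith
  refine (Real.exp_le_exp.mpr h2).trans ?_
  rw [Real.exp_neg, one_div]
  gcongr
  linarith [Real.add_one_le_exp 1]

/-- The random subspace argument: forms `K j` on `ℂ^k` with values in `[0, 2]` on the unit sphere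
are simultaneously at most `tr (K j) / k + δ` on the unit sphere of an `m`-dimensional subspace,
as soon as there are few of them, and `m` is small, compared with `exp (δ² k / 144)`. -/
theorem exists_isometry_expVal_le {J : Type*} [Fintype J] [Nonempty J] (hm : 0 < m)
    (K : J → Matrix (Fin k) (Fin k) ℂ) (hK : ∀ j, (K j).IsHermitian)
    (hK2 : ∀ j φ, sqNorm φ = 1 → 0 ≤ expVal (K j) φ ∧ expVal (K j) φ ≤ 2)
    {δ : ℝ} (hδ : 0 < δ) (hδ1 : δ ≤ 1) {n : ℕ} (hn : 120 * (m : ℝ) ^ 2 / δ ≤ n)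
    (hcard : (Fintype.card J : ℝ) * (2 * n + 1) ^ (2 * m) * Real.exp (-(δ ^ 2 * k / 144)) < 1 / 2) :
    ∃ W : Matrix (Fin k) (Fin m) ℂ, Wᴴ * W = 1 ∧
      ∀ j u, sqNorm u = 1 → expVal (K j) (W *ᵥ u) ≤ (K j).trace.re / k + δ := by
  classical
  have hm' : (0 : ℝ) < m := by exact_mod_cast hm
  have hn' : (0 : ℝ) < n := lt_of_lt_of_le (by positivity) hn
  have hn0 : 0 < n := by exact_mod_cast hn'
  have hk : 0 < k := by
    rcases Nat.eq_zero_or_pos k with rfl | hk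
    · exfalso
      have h1 : (1 : ℝ) ≤ Fintype.card J := by exact_mod_cast Fintype.card_pos
      have h2 : (1 : ℝ) ≤ (2 * n + 1) ^ (2 * m) := one_le_pow₀ (by linarith)
      simp only [Nat.cast_zero, mul_zero, zero_div, neg_zero, Real.exp_zero, mul_one] at hcard
      nlinarith
    · exact hk
  have hk' : (0 : ℝ) < k := by exact_mod_cast hk
  obtain ⟨T, hTcard, hT1, hTnet⟩ := exists_sphere_net m hn0
  -- The events to be avoided: a form is too large at the image of a net point, or the
  -- Hilbert-Schmidt norm of the matrix is too large to pass from the net to the sphere.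
  let bad : J → (Fin m → ℂ) → Set ((Fin k × Fin m) × Bool → ℝ) := fun j u =>
    {g | -(δ * k) ≤ expVal (K j) (toComplexMatrix g *ᵥ u) -
      ((K j).trace.re / k + δ) * sqNorm (toComplexMatrix g *ᵥ u)}
  let bad' : Set ((Fin k × Fin m) × Bool → ℝ) :=
    {g | 8 * (k * m : ℝ) ≤ ∑ x, ∑ j, ‖(toComplexMatrix g : Matrix (Fin k) (Fin m) ℂ) x j‖ ^ 2}
  have hmeas : stdNormal _ ((⋃ p ∈ (Finset.univ : Finset J) ×ˢ T, bad p.1 p.2) ∪ bad') < 1 := by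
    have h1 : stdNormal _ (⋃ p ∈ (Finset.univ : Finset J) ×ˢ T, bad p.1 p.2) ≤
        ENNReal.ofReal ((Fintype.card J : ℝ) * (2 * n + 1) ^ (2 * m) *
          Real.exp (-(δ ^ 2 * k / 144))) := by
      calc stdNormal _ (⋃ p ∈ (Finset.univ : Finset J) ×ˢ T, bad p.1 p.2)
          ≤ ∑ p ∈ (Finset.univ : Finset J) ×ˢ T, stdNormal _ (bad p.1 p.2) :=
            measure_biUnion_finset_le _ _
        _ ≤ ∑ _p ∈ (Finset.univ : Finset J) ×ˢ T,
            ENNReal.ofReal (Real.exp (-(δ ^ 2 * k / 144))) :=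
            Finset.sum_le_sum fun p hp => stdNormal_expVal_tail hk (hK p.1) (hK2 p.1) hδ hδ1
              (hT1 _ (Finset.mem_product.mp hp).2)
        _ = ENNReal.ofReal (((Fintype.card J * T.card : ℕ) : ℝ) *
            Real.exp (-(δ ^ 2 * k / 144))) := by
            rw [Finset.sum_const, Finset.card_product, Finset.card_univ, nsmul_eq_mul,
              ENNReal.ofReal_mul (Nat.cast_nonneg _), ENNReal.ofReal_natCast]
        _ ≤ _ := by
            refine ENNReal.ofReal_le_ofReal ?_
            have : (T.card : ℝ) ≤ (2 * n + 1) ^ (2 * m) := by exact_mod_cast hTcard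
            push_cast
            gcongr
    calc _ ≤ _ := measure_union_le _ _
      _ ≤ _ := add_le_add h1 (stdNormal_frobenius_tail hk hm)
      _ = ENNReal.ofReal (_ + 1 / 2) := (ENNReal.ofReal_add (by positivity) (by norm_num)).symm
      _ < 1 := by
          rw [ENNReal.ofReal_lt_one]
          linarith
  obtain ⟨g, hg⟩ : ∃ g, g ∉ (⋃ p ∈ (Finset.univ : Finset J) ×ˢ T, bad p.1 p.2) ∪ bad' := by
    by_contra h
    push Not at h
    rw [Set.eq_univ_of_forall h, measure_univ] at hmeas
    exact lt_irrefl _ hmeas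
  set G : Matrix (Fin k) (Fin m) ℂ := toComplexMatrix g with hG
  have hfro : ∑ x, ∑ j, ‖G x j‖ ^ 2 ≤ 8 * (k * m) := by
    by_contra h
    exact hg (Or.inr (not_le.mp h).le)
  have hgood : ∀ j, ∀ u ∈ T, expVal (K j) (G *ᵥ u) -
      ((K j).trace.re / k + δ) * sqNorm (G *ᵥ u) < -(δ * k) := by
    intro j u hu
    by_contra h
    refine hg (Or.inl (Set.mem_biUnion (x := (j, u)) ?_ (not_lt.mp h)))
    simp [hu]
  have hneg : ∀ j u, sqNorm u = 1 → expVal (K j) (G *ᵥ u) -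
      ((K j).trace.re / k + δ) * sqNorm (G *ᵥ u) < 0 := by
    intro j u hu
    obtain ⟨u', hu'T, hu'⟩ := hTnet u hu
    have h1 := hgood j u' hu'T
    rw [expVal_sub_eq_sum (hK j)] at h1 ⊢
    have hU := (eigenvectorUnitary_isometry (hK j)).2
    have hle : ∀ v, sqNorm (((hK j).eigenvectorUnitary.1)ᴴ *ᵥ (G *ᵥ v)) ≤
        8 * (k * m) * sqNorm v := by
      intro v
      rw [sqNorm_mulVec_of_isometry hU]
      exact (sqNorm_mulVec_le G v).trans
        (mul_le_mul_of_nonneg_right hfro (sqNorm_nonneg _))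
    have hmn : 0 < 2 * m / (n : ℝ) := by positivity
    refine quadratic_lt_of_near (ρ := 2 * m / n) (F := 8 * (k * m))
      (abs_eigenvalues_sub_le hk (hK j) (hK2 j) hδ hδ1).1 hmn ?_ ?_ ?_ h1 ?_
    · simpa [hu] using hle u
    · simpa [hT1 u' hu'T] using hle u'
    · rw [← Matrix.mulVec_sub, ← Matrix.mulVec_sub]
      refine (hle _).trans ?_
      gcongr
      refine hu'.trans ?_
      have h2 : (1 : ℝ) ≤ m := by exact_mod_cast hm
      rw [div_pow]
      gcongr
      nlinarith
    · rw [div_le_iff₀ hδ] at hn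
      rw [show 15 / 2 * (2 * m / (n : ℝ)) * (8 * (k * m)) = k * (120 * m ^ 2) / n by ring,
        div_le_iff₀ hn']
      nlinarith [mul_le_mul_of_nonneg_left hn hk'.le]
  -- By homogeneity the strict inequality holds at all `v ≠ 0`; it also forces `G v ≠ 0`.
  have hscale : ∀ j v, v ≠ 0 → expVal (K j) (G *ᵥ v) -
      ((K j).trace.re / k + δ) * sqNorm (G *ᵥ v) < 0 := by
    intro j v hv
    have hpos : 0 < sqNorm v := by
      obtain ⟨x, hx⟩ := Function.ne_iff.mp hv
      exact Finset.sum_pos' (fun _ _ => by positivity)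
        ⟨x, Finset.mem_univ x, by have := norm_pos_iff.mpr hx; positivity⟩
    have hsm : ∀ {f : ℕ} (r : ℝ) (w : Fin f → ℂ), sqNorm ((r : ℂ) • w) = r ^ 2 * sqNorm w := by
      intro f r w
      simp only [sqNorm, Pi.smul_apply, smul_eq_mul, norm_mul, mul_pow, Finset.mul_sum,
        Complex.norm_real, Real.norm_eq_abs, sq_abs]
    set r : ℝ := (Real.sqrt (sqNorm v))⁻¹
    have hr2 : r ^ 2 * sqNorm v = 1 := by
      rw [inv_pow, Real.sq_sqrt hpos.le, inv_mul_cancel₀ hpos.ne']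
    have h1 := hneg j ((r : ℂ) • v) (by rw [hsm, hr2])
    have h2 : expVal (K j) ((r : ℂ) • (G *ᵥ v)) = r ^ 2 * expVal (K j) (G *ᵥ v) := by
      rw [expVal, expVal, Matrix.mulVec_smul, star_smul, smul_dotProduct, dotProduct_smul,
        smul_smul, RCLike.star_def, Complex.conj_ofReal, ← Complex.ofReal_mul, ← sq, smul_eq_mul,
        Complex.re_ofReal_mul]
    rw [Matrix.mulVec_smul, hsm, h2] at h1
    have hr : 0 < r ^ 2 := by
      have : 0 < r := by positivity
      positivity
    by_contra h3
    nlinarith [mul_nonneg hr.le (not_lt.mp h3)]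
  have hinj : ∀ u, G *ᵥ u = 0 → u = 0 := by
    intro u hu
    by_contra h
    obtain ⟨j⟩ := ‹Nonempty J›
    have := hscale j u h
    rw [hu] at this
    simp [expVal, sqNorm] at this
  obtain ⟨W, hW, hWG⟩ := exists_isometry_of_injective hinj
  refine ⟨W, hW, fun j u hu => ?_⟩
  obtain ⟨v, hv⟩ := hWG u
  have hWu : sqNorm (W *ᵥ u) = 1 := by rw [sqNorm_mulVec_of_isometry hW, hu]
  have hv0 : v ≠ 0 := by
    rintro rfl
    rw [hv, Matrix.mulVec_zero] at hWu
    simp [sqNorm] at hWu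
  have := hscale j v hv0
  rw [← hv, hWu] at this
  linarith

end RandomSubspace

/-! ### Operations on channels -/

section Channels

variable {a b c : Type*} [Fintype a] [Fintype b] [Fintype c]

/-- The channel `X ↦ W X W*` of an isometry `W`. -/
noncomputable def Channel.ofIsometry [DecidableEq a] (W : Matrix b a ℂ) (hW : Wᴴ * W = 1) :
    Channel a b where
  toMap :=
    { toFun := fun X => W * X * Wᴴ
      map_add' := fun X Y => by rw [Matrix.mul_add, Matrix.add_mul]
      map_smul' := fun c X => by simp }
  completelyPositive r X hX := by
    let M : Matrix (Fin r × b) (Fin r × a) ℂ := Matrix.of fun p q => if p.1 = q.1 then W p.2 q.2 else 0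
    convert! hX.mul_mul_conjTranspose_same M using 1
    ext p q
    simp only [idTensor, LinearMap.coe_mk, AddHom.coe_mk, Matrix.of_apply, Matrix.mul_apply,
      Matrix.conjTranspose_apply, M, Fintype.sum_prod_type, ite_mul, zero_mul]
    rw [Finset.sum_eq_single q.1]
    · simp only [if_true]
      refine Finset.sum_congr rfl fun y _ => ?_
      congr 1
      rw [Finset.sum_eq_single p.1]
      · simp
      · intro z _ hz
        simp [Ne.symm hz]
      · simp
    · intro z _ hz
      simp [Ne.symm hz]
    · simp
  tracePreserving X := by
    simp only [LinearMap.coe_mk, AddHom.coe_mk]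
    rw [Matrix.trace_mul_comm, ← Matrix.mul_assoc, hW, Matrix.one_mul]

/-- The composition of two channels. -/
def Channel.comp (Ψ : Channel b c) (Φ : Channel a b) : Channel a c where
  toMap := Ψ.toMap ∘ₗ Φ.toMap
  completelyPositive r X hX := Ψ.completelyPositive r _ (Φ.completelyPositive r X hX)
  tracePreserving X := by
    rw [LinearMap.comp_apply, Ψ.tracePreserving, Φ.tracePreserving]

theorem expVal_mul_mul_conjTranspose (U : Matrix b a ℂ) (X : Matrix a a ℂ) (v : b → ℂ) :
    expVal (U * X * Uᴴ) v = expVal X (Uᴴ *ᵥ v) := by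
  rw [expVal, expVal, star_mulVec_dotProduct, Matrix.conjTranspose_conjTranspose,
    Matrix.mulVec_mulVec, Matrix.mulVec_mulVec]

end Channels

/-! ### Modified encoders and decoders -/

section Pairs

variable {a b S : Type*} [Fintype a] [Fintype b] [DecidableEq a] {l k d : ℕ}

/-- The encoder-decoder pair restricted to the range of an isometry `W : ℂ^m → ℂ^k`. -/
noncomputable def CodePair.restrict (p : CodePair a b l k d) {m : ℕ} (W : Matrix (Fin k) (Fin m) ℂ)
    (hW : Wᴴ * W = 1) : CodePair a b l m d :=
  (p.1.comp (Channel.ofIsometry W hW), p.2)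

theorem CodePair.pureFidelity_restrict (p : CodePair a b l k d) {m : ℕ}
    (W : Matrix (Fin k) (Fin m) ℂ) (hW : Wᴴ * W = 1) (V : Matrix (Fin d) (Fin k) ℂ)
    (N : S → Channel a b) (s : Fin l → S) (φ : Fin m → ℂ) :
    pureFidelity (V * W) ((p.restrict W hW).total N s) φ =
      pureFidelity V (p.total N s) (W *ᵥ φ) := by
  have h : (p.restrict W hW).total N s (ketBra φ) = p.total N s (ketBra (W *ᵥ φ)) := by
    rw [← mul_ketBra_mul]
    rfl
  rw [pureFidelity, pureFidelity, h, Matrix.mulVec_mulVec]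

/-- The encoder-decoder pair conjugated by a unitary `U` of `ℂ^k`, which the decoder undoes on
the subspace `V ℂ^k` while leaving the orthogonal complement alone. -/
theorem CodePair.exists_conj (p : CodePair a b l k d) (U : Matrix (Fin k) (Fin k) ℂ)
    (hU : Uᴴ * U = 1) (V : Matrix (Fin d) (Fin k) ℂ) (hV : Vᴴ * V = 1) :
    ∃ q : CodePair a b l k d, ∀ (N : S → Channel a b) (s : Fin l → S) (φ : Fin k → ℂ),
      pureFidelity V (q.total N s) φ = pureFidelity V (p.total N s) (U *ᵥ φ) := by
  let D : Matrix (Fin d) (Fin d) ℂ := 1 - V * Vᴴ + V * Uᴴ * Vᴴ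
  have hDH : Dᴴ = 1 - V * Vᴴ + V * U * Vᴴ := by
    simp [D, Matrix.conjTranspose_mul, Matrix.mul_assoc]
  have hU' : U * Uᴴ = 1 := mul_eq_one_comm.mp hU
  have hDV : Dᴴ * V = V * U := by
    rw [hDH, Matrix.add_mul, Matrix.sub_mul, Matrix.one_mul, Matrix.mul_assoc V Vᴴ V, hV,
      Matrix.mul_one, sub_self, zero_add, Matrix.mul_assoc (V * U), hV, Matrix.mul_one]
  have hD : Dᴴ * D = 1 := by
    have h1 : Dᴴ * D = Dᴴ - Dᴴ * V * Vᴴ + Dᴴ * V * Uᴴ * Vᴴ := by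
      simp only [D, Matrix.mul_add, Matrix.mul_sub, Matrix.mul_one, Matrix.mul_assoc]
    rw [h1, hDV, hDH, Matrix.mul_assoc V U Uᴴ, hU', Matrix.mul_one]
    abel
  refine ⟨(p.1.comp (Channel.ofIsometry U hU), (Channel.ofIsometry D hD).comp p.2), ?_⟩
  intro N s φ
  have h : CodePair.total (p.1.comp (Channel.ofIsometry U hU),
      (Channel.ofIsometry D hD).comp p.2) N s (ketBra φ) =
      D * p.total N s (ketBra (U *ᵥ φ)) * Dᴴ := by
    rw [← mul_ketBra_mul]
    rfl
  rw [pureFidelity, pureFidelity, h, expVal_mul_mul_conjTranspose, Matrix.mulVec_mulVec, hDV,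
    Matrix.mulVec_mulVec]

variable {V : Matrix (Fin d) (Fin k) ℂ}

theorem CodePair.pureFidelity_nonneg (p : CodePair a b l k d) (hV : Vᴴ * V = 1)
    (N : S → Channel a b) (s : Fin l → S) (φ : Fin k → ℂ) :
    0 ≤ pureFidelity V (p.total N s) φ := by
  obtain ⟨ι, _, A, -, hf, -⟩ := p.exists_operators N s hV
  rw [hf]
  exact vecFid_nonneg A φ

theorem CodePair.pureFidelity_le_one (p : CodePair a b l k d) (hV : Vᴴ * V = 1)
    (N : S → Channel a b) (s : Fin l → S) {φ : Fin k → ℂ} (hφ : sqNorm φ = 1) :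
    pureFidelity V (p.total N s) φ ≤ 1 := by
  obtain ⟨ι, _, A, hA, hf, -⟩ := p.exists_operators N s hV
  rw [hf]
  exact hA.vecFid_le_one hφ

theorem CodePair.entanglementFidelity_nonneg (p : CodePair a b l k d) (hV : Vᴴ * V = 1)
    (N : S → Channel a b) (s : Fin l → S) : 0 ≤ entanglementFidelity V (p.total N s) := by
  obtain ⟨ι, _, A, -, -, hF⟩ := p.exists_operators N s hV
  rw [hF]
  exact traceFid_nonneg A

theorem CodePair.entanglementFidelity_le_one (p : CodePair a b l k d) (hV : Vᴴ * V = 1)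
    (N : S → Channel a b) (s : Fin l → S) : entanglementFidelity V (p.total N s) ≤ 1 := by
  obtain ⟨ι, _, A, hA, -, hF⟩ := p.exists_operators N s hV
  rw [hF]
  exact hA.traceFid_le_one

theorem CodePair.avg_flatVec_le (p : CodePair a b l k d) (hk : 0 < k) (hV : Vᴴ * V = 1)
    (N : S → Channel a b) (s : Fin l → S) :
    ((2 : ℝ) ^ k)⁻¹ * ∑ ε : Fin k → ℤˣ, pureFidelity V (p.total N s) (flatVec ε) ≤
      entanglementFidelity V (p.total N s) + 2 / k := by
  obtain ⟨ι, _, A, hA, hf, hF⟩ := p.exists_operators N s hV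
  simp only [hf, hF]
  exact hA.avg_flatVec_le hk

theorem CodePair.entanglementFidelity_le_avg_signedShift [NeZero k] (p : CodePair a b l k d)
    (hV : Vᴴ * V = 1) (N : S → Channel a b) (s : Fin l → S) {φ : Fin k → ℂ} (hφ : sqNorm φ = 1) :
    entanglementFidelity V (p.total N s) ≤ ((2 : ℝ) ^ k * k)⁻¹ *
      ∑ u : (Fin k → ℤˣ) × Fin k, pureFidelity V (p.total N s) (signedShift u.1 u.2 *ᵥ φ) := by
  obtain ⟨ι, _, A, -, hf, hF⟩ := p.exists_operators N s hV
  simp only [hf, hF]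
  exact traceFid_le_avg_signedShift A hφ

/-- For a fixed encoder-decoder pair there is a large subspace of `ℂ^k` on which, for all words
`s` at once, the fidelity of every vector is almost as large as the entanglement fidelity. -/
theorem CodePair.exists_restrict [Fintype S] [Nonempty S] (p : CodePair a b l k d) (hk : 0 < k)
    (hV : Vᴴ * V = 1) (N : S → Channel a b) {m : ℕ} (hm : 0 < m) {δ : ℝ} (hδ : 0 < δ)
    (hδ1 : δ ≤ 1) {n : ℕ} (hn : 120 * (m : ℝ) ^ 2 / δ ≤ n)
    (hcard : (Fintype.card S : ℝ) ^ l * (2 * n + 1) ^ (2 * m) *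
      Real.exp (-(δ ^ 2 * k / 144)) < 1 / 2) :
    ∃ (W : Matrix (Fin k) (Fin m) ℂ) (hW : Wᴴ * W = 1), ∀ (s : Fin l → S) (φ : Fin m → ℂ),
      sqNorm φ = 1 → entanglementFidelity V (p.total N s) - 2 * δ ≤
        pureFidelity (V * W) ((p.restrict W hW).total N s) φ := by
  have hk' : (0 : ℝ) < k := by exact_mod_cast hk
  have key : ∀ s : Fin l → S, ∃ K : Matrix (Fin k) (Fin k) ℂ, K.IsHermitian ∧
      (∀ φ, sqNorm φ = 1 → 0 ≤ expVal K φ ∧ expVal K φ ≤ 2) ∧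
      K.trace.re = k * (1 - entanglementFidelity V (p.total N s)) ∧
      ∀ φ, sqNorm φ = 1 → 2 * (1 - expVal K φ) - entanglementFidelity V (p.total N s) ≤
        pureFidelity V (p.total N s) φ := by
    intro s
    obtain ⟨ι, _, A, hA, hf, hF⟩ := p.exists_operators N s hV
    simp only [hf, hF]
    exact hA.exists_quadraticForm hk
  choose K hK hK2 hKtr hKf using key
  obtain ⟨W, hW, hWK⟩ := exists_isometry_expVal_le hm K hK hK2 hδ hδ1 hn (by simpa using hcard)
  refine ⟨W, hW, fun s φ hφ => ?_⟩
  rw [CodePair.pureFidelity_restrict]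
  have h1 := hKf s (W *ᵥ φ) (by rw [sqNorm_mulVec_of_isometry hW, hφ])
  have h2 := hWK s φ hφ
  rw [hKtr, mul_div_cancel_left₀ _ hk'.ne'] at h2
  linarith

end Pairs

/-! ### Codes of finite support -/

section FiniteCodes

variable {a b S : Type*} [Fintype a] [Fintype b] {l k d : ℕ}

/-- The random code that uses the pair `p i` with probability `w i`. All sets of pairs are
measurable. -/
noncomputable def finiteCode {ι : Type*} [Fintype ι] (hk : 0 < k) (V : Matrix (Fin d) (Fin k) ℂ)
    (hV : Vᴴ * V = 1) (w : ι → ℝ) (hw : ∀ i, 0 ≤ w i) (hw1 : ∑ i, w i = 1)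
    (p : ι → CodePair a b l k d) : RandomCode a b l k where
  pos := hk
  d := d
  V := V
  isometry := hV
  sigma := ⊤
  singleton _ := trivial
  μ := ∑ i, ENNReal.ofReal (w i) • @Measure.dirac _ ⊤ (p i)
  isProb := ⟨by
    simp only [Measure.finsetSum_apply, Measure.smul_apply, measure_univ, smul_eq_mul, mul_one]
    rw [← ENNReal.ofReal_sum_of_nonneg fun i _ => hw i, hw1, ENNReal.ofReal_one]⟩

variable {ι : Type*} [Fintype ι] (hk : 0 < k) {V : Matrix (Fin d) (Fin k) ℂ}
    (hV : Vᴴ * V = 1) {w : ι → ℝ} (hw : ∀ i, 0 ≤ w i) (hw1 : ∑ i, w i = 1)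
    (p : ι → CodePair a b l k d)

theorem integral_finiteCode (f : CodePair a b l k d → ℝ) :
    @integral _ ℝ _ _ (finiteCode hk V hV w hw hw1 p).sigma (finiteCode hk V hV w hw hw1 p).μ f =
      ∑ i, w i * f (p i) := by
  let _ : MeasurableSpace (CodePair a b l k d) := ⊤
  have : MeasurableSingletonClass (CodePair a b l k d) := ⟨fun _ => trivial⟩
  change ∫ x, f x ∂(∑ i, ENNReal.ofReal (w i) • Measure.dirac (p i)) = _
  rw [integral_finsetSum_measure fun i _ => (integrable_dirac (by simp)).smul_measure
    ENNReal.ofReal_ne_top]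
  refine Finset.sum_congr rfl fun i _ => ?_
  rw [integral_smul_measure, integral_dirac, ENNReal.toReal_ofReal (hw i), smul_eq_mul]

theorem finiteCode_isDeterministic {p₀ : CodePair a b l k d} (hp : ∀ i, p i = p₀) :
    (finiteCode hk V hV w hw hw1 p).IsDeterministic := by
  let _ : MeasurableSpace (CodePair a b l k d) := ⊤
  have : MeasurableSingletonClass (CodePair a b l k d) := ⟨fun _ => trivial⟩
  have hμ : (finiteCode hk V hV w hw hw1 p).μ = Measure.dirac p₀ := by
    change (∑ i, ENNReal.ofReal (w i) • Measure.dirac (p i)) = Measure.dirac p₀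
    simp only [hp]
    rw [← Finset.sum_smul, ← ENNReal.ofReal_sum_of_nonneg fun i _ => hw i, hw1,
      ENNReal.ofReal_one, one_smul]
  have h1 : Measure.dirac p₀ {p₀} = 1 := by simp
  have h2 : ∀ A : Set (CodePair a b l k d), p₀ ∉ A → Measure.dirac p₀ A = 0 := by
    intro A hA
    simp [hA]
  refine ⟨p₀, ?_, fun A _ hA => ?_⟩
  · rw [hμ]
    exact h1
  · rw [hμ]
    exact h2 A hA

/-- An integral of finitely many bounded functions is approximated by finite averages of their
values: it lies in the closed convex hull of the joint range. -/
theorem exists_finite_average {Ω J : Type*} [MeasurableSpace Ω] (μ : Measure Ω)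
    [IsProbabilityMeasure μ] [Fintype J] (f : J → Ω → ℝ) (hf : ∀ j, Measurable (f j))
    (hf1 : ∀ j x, |f j x| ≤ 1) {ε : ℝ} (hε : 0 < ε) :
    ∃ (n : ℕ) (w : Fin n → ℝ) (x : Fin n → Ω), (∀ i, 0 ≤ w i) ∧ ∑ i, w i = 1 ∧
      ∀ j, |∑ i, w i * f j (x i) - ∫ y, f j y ∂μ| ≤ ε := by
  let F : Ω → J → ℝ := fun y j => f j y
  have hFint : ∀ j, Integrable (fun y => F y j) μ := fun j =>
    Integrable.of_bound (hf j).aestronglyMeasurable 1 (ae_of_all _ fun y => hf1 j y)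
  have hmem : ∫ y, F y ∂μ ∈ closure (convexHull ℝ (Set.range F)) :=
    Convex.integral_mem (convex_convexHull ℝ _).closure isClosed_closure
      (ae_of_all _ fun y => subset_closure (subset_convexHull ℝ _ ⟨y, rfl⟩))
      (Integrable.of_eval hFint)
  obtain ⟨z, hz, hdist⟩ := Metric.mem_closure_iff.mp hmem ε hε
  obtain ⟨ι, _, w, y, hw, hw1, hy, rfl⟩ := mem_convexHull_iff_exists_fintype.mp hz
  choose x hx using hy
  let e := Fintype.equivFin ι
  refine ⟨_, w ∘ e.symm, x ∘ e.symm, fun i => hw _, ?_, fun j => ?_⟩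
  · rw [← hw1]
    exact Equiv.sum_comp e.symm w
  · have h1 : ∑ i, (w ∘ e.symm) i * f j ((x ∘ e.symm) i) = (∑ i, w i • y i) j := by
      rw [Finset.sum_apply]
      refine Fintype.sum_equiv e.symm _ _ fun i => ?_
      rw [Pi.smul_apply, smul_eq_mul, ← hx]
      rfl
    have h2 : ∫ y, f j y ∂μ = (∫ y, F y ∂μ) j := (eval_integral hFint j).symm
    rw [h1, h2, ← Real.dist_eq, dist_comm]
    exact (dist_le_pi_dist _ _ j).trans hdist.le

theorem RandomCode.integral_of_isDeterministic (C : RandomCode a b l k) {p₀ : CodePair a b l k C.d}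
    (h1 : C.μ {p₀} = 1) (h2 : ∀ A, MeasurableSet[C.sigma] A → p₀ ∉ A → C.μ A = 0)
    (f : CodePair a b l k C.d → ℝ) : @integral _ ℝ _ _ C.sigma C.μ f = f p₀ := by
  let _ := C.sigma
  have := C.isProb
  have hae : f =ᵐ[C.μ] fun _ => f p₀ := by
    have h3 : C.μ {p₀}ᶜ = 0 := h2 _ (C.singleton p₀).compl (by simp)
    rw [Filter.EventuallyEq, ae_iff]
    refine measure_mono_null (fun x hx => ?_) h3
    rintro rfl
    exact hx rfl
  rw [integral_congr_ae hae, integral_const, probReal_univ, one_smul]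

/-- Every random code is approximated, on finitely many bounded measurable functions, by pairs
used with finitely many probabilities. A deterministic code is replaced by its single pair. -/
theorem RandomCode.exists_finite_average (C : RandomCode a b l k) {J : Type*} [Fintype J]
    (f : J → CodePair a b l k C.d → ℝ) (hf : ∀ j, Measurable[C.sigma] (f j))
    (hf1 : ∀ j x, |f j x| ≤ 1) {ε : ℝ} (hε : 0 < ε) :
    ∃ (n : ℕ) (w : Fin n → ℝ) (p : Fin n → CodePair a b l k C.d), (∀ i, 0 ≤ w i) ∧
      ∑ i, w i = 1 ∧ (∀ j, |∑ i, w i * f j (p i) - @integral _ ℝ _ _ C.sigma C.μ (f j)| ≤ ε) ∧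
      (C.IsDeterministic → ∃ p₀, ∀ i, p i = p₀) := by
  by_cases hdet : C.IsDeterministic
  · obtain ⟨p₀, h1, h2⟩ := hdet
    refine ⟨1, fun _ => 1, fun _ => p₀, fun _ => zero_le_one, by simp, fun j => ?_,
      fun _ => ⟨p₀, fun _ => rfl⟩⟩
    rw [C.integral_of_isDeterministic h1 h2]
    simp [hε.le]
  · let _ := C.sigma
    have := C.isProb
    obtain ⟨n, w, x, h1, h2, h3⟩ := AVQC.exists_finite_average C.μ f hf hf1 hε
    exact ⟨n, w, x, h1, h2, h3, fun h => absurd h hdet⟩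

end FiniteCodes

/-! ### Transfer between the two transmission tasks -/

namespace RandomCode

variable {a b S : Type*} [Fintype a] [Fintype b] [DecidableEq a] {l k : ℕ}

theorem bddBelow_entanglement (C : RandomCode a b l k) (N : S → Channel a b) :
    BddBelow (Set.range fun s : Fin l → S =>
      @integral _ ℝ _ _ C.sigma C.μ fun p => entanglementFidelity C.V (p.total N s)) := by
  let _ := C.sigma
  refine ⟨0, ?_⟩
  rintro _ ⟨s, rfl⟩
  exact integral_nonneg fun p => p.entanglementFidelity_nonneg C.isometry N s

theorem entanglementPerformance_nonneg (C : RandomCode a b l k) (N : S → Channel a b) :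
    0 ≤ C.entanglementPerformance N := by
  let _ := C.sigma
  exact Real.iInf_nonneg fun s => integral_nonneg fun p =>
    p.entanglementFidelity_nonneg C.isometry N s

theorem entanglementPerformance_le (C : RandomCode a b l k) (N : S → Channel a b)
    (s : Fin l → S) : C.entanglementPerformance N ≤
      @integral _ ℝ _ _ C.sigma C.μ fun p => entanglementFidelity C.V (p.total N s) :=
  ciInf_le (C.bddBelow_entanglement N) s

theorem entanglementPerformance_le_one [Nonempty S] (C : RandomCode a b l k)
    (N : S → Channel a b) : C.entanglementPerformance N ≤ 1 := by
  let _ := C.sigma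
  have := C.isProb
  obtain ⟨s⟩ : Nonempty (Fin l → S) := inferInstance
  refine (C.entanglementPerformance_le N s).trans ((Real.le_norm_self _).trans ?_)
  refine (norm_integral_le_of_norm_le_const (C := 1) (ae_of_all _ fun p => ?_)).trans_eq (by simp)
  rw [Real.norm_of_nonneg (p.entanglementFidelity_nonneg C.isometry N s)]
  exact p.entanglementFidelity_le_one C.isometry N s

theorem integral_pureFidelity_nonneg (C : RandomCode a b l k) (N : S → Channel a b)
    (s : Fin l → S) (φ : Fin k → ℂ) :
    0 ≤ @integral _ ℝ _ _ C.sigma C.μ fun p => pureFidelity C.V (p.total N s) φ := by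
  let _ := C.sigma
  exact integral_nonneg fun p => p.pureFidelity_nonneg C.isometry N s φ

theorem strongSubspacePerformance_nonneg (C : RandomCode a b l k) (N : S → Channel a b) :
    0 ≤ C.strongSubspacePerformance N :=
  Real.iInf_nonneg fun s => Real.iInf_nonneg fun φ => C.integral_pureFidelity_nonneg N s φ

theorem strongSubspacePerformance_le (C : RandomCode a b l k) (N : S → Channel a b)
    (s : Fin l → S) {φ : Fin k → ℂ} (hφ : sqNorm φ = 1) : C.strongSubspacePerformance N ≤
      @integral _ ℝ _ _ C.sigma C.μ fun p => pureFidelity C.V (p.total N s) φ := by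
  refine (ciInf_le ⟨0, ?_⟩ s).trans
    (ciInf_le (f := fun φ : {φ : Fin k → ℂ // star φ ⬝ᵥ φ = 1} =>
      @integral _ ℝ _ _ C.sigma C.μ fun p => pureFidelity C.V (p.total N s) φ) ⟨0, ?_⟩
      ⟨φ, (star_dotProduct_self_eq_one_iff φ).mpr hφ⟩)
  · rintro _ ⟨s, rfl⟩
    exact Real.iInf_nonneg fun φ => C.integral_pureFidelity_nonneg N s φ
  · rintro _ ⟨φ, rfl⟩
    exact C.integral_pureFidelity_nonneg N s φ

theorem strongSubspacePerformance_le_one [Nonempty S] (C : RandomCode a b l k)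
    (N : S → Channel a b) : C.strongSubspacePerformance N ≤ 1 := by
  let _ := C.sigma
  have := C.isProb
  obtain ⟨s⟩ : Nonempty (Fin l → S) := inferInstance
  have h1 := sqNorm_flatVec C.pos (1 : Fin k → ℤˣ)
  refine (C.strongSubspacePerformance_le N s h1).trans ((Real.le_norm_self _).trans ?_)
  refine (norm_integral_le_of_norm_le_const (C := 1) (ae_of_all _ fun p => ?_)).trans_eq (by simp)
  rw [Real.norm_of_nonneg (p.pureFidelity_nonneg C.isometry N s _)]
  exact p.pureFidelity_le_one C.isometry N s h1

theorem le_strongSubspacePerformance [Nonempty S] (C : RandomCode a b l k) (N : S → Channel a b)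
    {c : ℝ} (h : ∀ (s : Fin l → S) (φ : Fin k → ℂ), sqNorm φ = 1 →
      c ≤ @integral _ ℝ _ _ C.sigma C.μ fun p => pureFidelity C.V (p.total N s) φ) :
    c ≤ C.strongSubspacePerformance N := by
  have : Nonempty {φ : Fin k → ℂ // star φ ⬝ᵥ φ = 1} := ⟨flatVec 1,
    (star_dotProduct_self_eq_one_iff _).mpr (sqNorm_flatVec C.pos 1)⟩
  exact le_ciInf fun s => le_ciInf fun φ => h s φ ((star_dotProduct_self_eq_one_iff _).mp φ.2)

/-- A strong subspace transmission code yields an entanglement transmission code of the same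
dimension. The measure is replaced by one of finite support, since the entanglement fidelity need
not be measurable for the original sigma-algebra. -/
theorem exists_entanglementCode [Finite S] [Nonempty S] (C : RandomCode a b l k)
    (N : S → Channel a b) (hC : C.IsStrongSubspaceCode N) {ε : ℝ} (hε : 0 < ε) :
    ∃ C' : RandomCode a b l k, C'.IsEntanglementCode N ∧
      (C.IsDeterministic → C'.IsDeterministic) ∧
      C.strongSubspacePerformance N - (2 / k + ε) ≤ C'.entanglementPerformance N := by
  have := Fintype.ofFinite S
  obtain ⟨n, w, p, hw, hw1, happrox, hdet⟩ := C.exists_finite_average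
    (J := (Fin l → S) × (Fin k → ℤˣ))
    (fun j p => pureFidelity C.V (p.total N j.1) (flatVec j.2))
    (fun j => hC j.1 _ ((star_dotProduct_self_eq_one_iff _).mpr (sqNorm_flatVec C.pos j.2)))
    (fun j p => by
      rw [abs_of_nonneg (p.pureFidelity_nonneg C.isometry N j.1 _)]
      exact p.pureFidelity_le_one C.isometry N j.1 (sqNorm_flatVec C.pos j.2)) hε
  refine ⟨finiteCode C.pos C.V C.isometry w hw hw1 p, fun s => measurable_from_top, fun h => ?_,
    le_ciInf fun s => ?_⟩
  · obtain ⟨p₀, hp⟩ := hdet h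
    exact finiteCode_isDeterministic C.pos C.isometry hw hw1 p hp
  · refine le_of_le_of_eq ?_ (integral_finiteCode C.pos C.isometry hw hw1 p _).symm
    change _ ≤ ∑ i, w i * entanglementFidelity C.V ((p i).total N s)
    have h2k : (0 : ℝ) < 2 ^ k := by positivity
    have h1 : ∀ i, w i * (((2 : ℝ) ^ k)⁻¹ * ∑ ε : Fin k → ℤˣ,
        pureFidelity C.V ((p i).total N s) (flatVec ε) - 2 / k) ≤
        w i * entanglementFidelity C.V ((p i).total N s) := fun i =>
      mul_le_mul_of_nonneg_left (sub_le_iff_le_add.mpr ((p i).avg_flatVec_le C.pos C.isometry N s))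
        (hw i)
    have h2 : ∀ σ : Fin k → ℤˣ, C.strongSubspacePerformance N - ε ≤
        ∑ i, w i * pureFidelity C.V ((p i).total N s) (flatVec σ) := by
      intro σ
      have h3 := C.strongSubspacePerformance_le N s (sqNorm_flatVec C.pos σ)
      have h4 := (abs_le.mp (happrox (s, σ))).1
      dsimp only at h4
      linarith
    calc C.strongSubspacePerformance N - (2 / k + ε)
        = ((2 : ℝ) ^ k)⁻¹ * ∑ _σ : Fin k → ℤˣ, (C.strongSubspacePerformance N - ε) - 2 / k := by
          rw [Finset.sum_const, Finset.card_univ, card_signs, nsmul_eq_mul]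
          push_cast
          rw [inv_mul_cancel_left₀ h2k.ne']
          ring
      _ ≤ ((2 : ℝ) ^ k)⁻¹ * ∑ σ : Fin k → ℤˣ, ∑ i, w i *
            pureFidelity C.V ((p i).total N s) (flatVec σ) - 2 / k := by
          gcongr with σ
          exact h2 σ
      _ = ∑ i, w i * (((2 : ℝ) ^ k)⁻¹ * ∑ ε : Fin k → ℤˣ,
            pureFidelity C.V ((p i).total N s) (flatVec ε) - 2 / k) := by
          simp only [mul_sub, Finset.sum_sub_distrib]
          rw [← Finset.sum_mul, hw1, one_mul, Finset.sum_comm, Finset.mul_sum]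
          congr 1
          refine Finset.sum_congr rfl fun i _ => ?_
          rw [← Finset.mul_sum]
          ring
      _ ≤ _ := Finset.sum_le_sum fun i _ => h1 i

/-- Encoder and decoder share a random signed cyclic shift: this turns an entanglement
transmission code into a random strong subspace transmission code of the same dimension. -/
theorem exists_strongSubspaceCode [Finite S] [Nonempty S] (C : RandomCode a b l k)
    (N : S → Channel a b) (hC : C.IsEntanglementCode N) {ε : ℝ} (hε : 0 < ε) :
    ∃ C' : RandomCode a b l k, C'.IsStrongSubspaceCode N ∧
      C.entanglementPerformance N - ε ≤ C'.strongSubspacePerformance N := by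
  have := Fintype.ofFinite S
  have : NeZero k := ⟨C.pos.ne'⟩
  have hk : (0 : ℝ) < k := by exact_mod_cast C.pos
  obtain ⟨n, w, p, hw, hw1, happrox, -⟩ := C.exists_finite_average
    (fun (s : Fin l → S) p => entanglementFidelity C.V (p.total N s)) hC
    (fun s p => by
      rw [abs_of_nonneg (p.entanglementFidelity_nonneg C.isometry N s)]
      exact p.entanglementFidelity_le_one C.isometry N s) hε
  choose q hq using fun (p : CodePair a b l k C.d) (u : (Fin k → ℤˣ) × Fin k) =>
    p.exists_conj (S := S) (signedShift u.1 u.2) (signedShift_isometry u.1 u.2) C.V C.isometry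
  let w' : Fin n × ((Fin k → ℤˣ) × Fin k) → ℝ := fun i => w i.1 * ((2 : ℝ) ^ k * k)⁻¹
  have hw' : ∀ i, 0 ≤ w' i := fun i => mul_nonneg (hw _) (by positivity)
  have hw1' : ∑ i, w' i = 1 := by
    simp only [w', Fintype.sum_prod_type (f := fun i : Fin n × ((Fin k → ℤˣ) × Fin k) => _),
      Finset.sum_const, Finset.card_univ, Fintype.card_prod, card_signs, Fintype.card_fin,
      nsmul_eq_mul]
    push_cast
    rw [← Finset.mul_sum, ← Finset.sum_mul, hw1, one_mul, mul_inv_cancel₀ (by positivity)]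
  refine ⟨finiteCode C.pos C.V C.isometry w' hw' hw1' fun i => q (p i.1) i.2,
    fun s φ _ => measurable_from_top, le_strongSubspacePerformance _ _ fun s φ hφ => ?_⟩
  refine le_of_le_of_eq ?_ (integral_finiteCode C.pos C.isometry hw' hw1' _ _).symm
  change _ ≤ ∑ i : Fin n × ((Fin k → ℤˣ) × Fin k), w' i *
    pureFidelity C.V ((q (p i.1) i.2).total N s) φ
  have h1 : ∑ i : Fin n × ((Fin k → ℤˣ) × Fin k), w' i *
      pureFidelity C.V ((q (p i.1) i.2).total N s) φ = ∑ i, w i * (((2 : ℝ) ^ k * k)⁻¹ *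
        ∑ u : (Fin k → ℤˣ) × Fin k,
          pureFidelity C.V ((p i).total N s) (signedShift u.1 u.2 *ᵥ φ)) := by
    rw [Fintype.sum_prod_type]
    refine Finset.sum_congr rfl fun i _ => ?_
    simp only [w', hq, Finset.mul_sum, mul_assoc]
  have h2 := C.entanglementPerformance_le N s
  have h3 := (abs_le.mp (happrox s)).1
  rw [h1]
  calc C.entanglementPerformance N - ε ≤
        ∑ i, w i * entanglementFidelity C.V ((p i).total N s) := by linarith
    _ ≤ _ := Finset.sum_le_sum fun i _ => mul_le_mul_of_nonneg_left
        ((p i).entanglementFidelity_le_avg_signedShift C.isometry N s hφ) (hw i)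

/-- A deterministic entanglement transmission code, restricted to a suitable subspace, is a
deterministic strong subspace transmission code. -/
theorem exists_deterministic_strongSubspaceCode [Fintype S] [Nonempty S] (C : RandomCode a b l k)
    (N : S → Channel a b) (hC : C.IsDeterministic) {m : ℕ} (hm : 0 < m) {δ : ℝ} (hδ : 0 < δ)
    (hδ1 : δ ≤ 1) {n : ℕ} (hn : 120 * (m : ℝ) ^ 2 / δ ≤ n)
    (hcard : (Fintype.card S : ℝ) ^ l * (2 * n + 1) ^ (2 * m) *
      Real.exp (-(δ ^ 2 * k / 144)) < 1 / 2) :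
    ∃ C' : RandomCode a b l m, C'.IsStrongSubspaceCode N ∧ C'.IsDeterministic ∧
      C.entanglementPerformance N - 2 * δ ≤ C'.strongSubspacePerformance N := by
  obtain ⟨p, h1, h2⟩ := hC
  obtain ⟨W, hW, hWf⟩ := p.exists_restrict C.pos C.isometry N hm hδ hδ1 hn hcard
  have hVW : (C.V * W)ᴴ * (C.V * W) = 1 := by
    rw [Matrix.conjTranspose_mul, Matrix.mul_assoc, ← Matrix.mul_assoc (C.V)ᴴ, C.isometry,
      Matrix.one_mul, hW]
  have hw : ∀ i : Unit, 0 ≤ (fun _ => 1 : Unit → ℝ) i := fun _ => zero_le_one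
  refine ⟨finiteCode hm (C.V * W) hVW (fun _ : Unit => 1) hw (by simp) fun _ => p.restrict W hW,
    fun s φ _ => measurable_from_top,
    finiteCode_isDeterministic hm hVW hw (by simp) _ fun _ => rfl,
    le_strongSubspacePerformance _ _ fun s φ hφ => ?_⟩
  refine le_of_le_of_eq ?_ (integral_finiteCode hm hVW hw (by simp) _ _).symm
  simp only [Finset.univ_unique, Finset.sum_const, Finset.card_singleton, one_smul, one_mul]
  refine le_trans (sub_le_sub_right ?_ _) (hWf s φ hφ)
  have h3 := C.entanglementPerformance_le N s
  rwa [C.integral_of_isDeterministic h1 h2] at h3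

/-- Every deterministic code can be given a sigma-algebra for which all functions are measurable. -/
theorem IsDeterministic.exists_strongSubspaceCode {C : RandomCode a b l k}
    (hC : C.IsDeterministic) (N : S → Channel a b) :
    ∃ C' : RandomCode a b l k, C'.IsStrongSubspaceCode N ∧ C'.IsDeterministic := by
  obtain ⟨p, -, -⟩ := hC
  have hw : ∀ i : Unit, 0 ≤ (fun _ => 1 : Unit → ℝ) i := fun _ => zero_le_one
  exact ⟨finiteCode C.pos C.V C.isometry (fun _ : Unit => 1) hw (by simp) fun _ => p,
    fun s φ _ => measurable_from_top,
    finiteCode_isDeterministic C.pos C.isometry hw (by simp) _ fun _ => rfl⟩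

end RandomCode

/-! ### Asymptotics -/

section Asymptotics

/-- A lower bound of a `liminf` survives a vanishing loss. -/
theorem le_liminf_of_sub_le {u v e : ℕ → ℝ} (hu : ∀ l, 0 ≤ u l ∧ u l ≤ 1)
    (hv : ∀ l, 0 ≤ v l ∧ v l ≤ 1) (he : Tendsto e atTop (nhds 0))
    (h : ∀ᶠ l in atTop, u l - e l ≤ v l) {c : ℝ} (hc : c ≤ liminf u atTop) :
    c ≤ liminf v atTop := by
  refine le_of_forall_lt_imp_le_of_dense fun x hx => ?_
  have h1 : ∀ᶠ l in atTop, x + (c - x) / 2 < u l := by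
    refine eventually_lt_of_lt_liminf (lt_of_lt_of_le (by linarith) hc) ?_
    exact isBoundedUnder_of ⟨0, fun l => (hu l).1⟩
  have h2 : ∀ᶠ l in atTop, e l < (c - x) / 2 := he.eventually_lt_const (by linarith)
  refine le_liminf_of_le (isBoundedUnder_of ⟨1, fun l => (hv l).2⟩).isCoboundedUnder_ge ?_
  filter_upwards [h, h1, h2] with l h h1 h2
  linarith

theorem eventually_rpow_le_of_lt_asymptoticRate {k : ℕ → ℕ} (hk : ∀ l, 0 < k l) {R : ℝ}
    (h : (R : EReal) < asymptoticRate k) : ∀ᶠ l : ℕ in atTop, (2 : ℝ) ^ (l * R) ≤ k l := by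
  filter_upwards [eventually_lt_of_lt_liminf h, eventually_gt_atTop 0] with l h1 hl
  have hl' : (0 : ℝ) < l := by exact_mod_cast hl
  have h2 : R < 1 / l * Real.logb 2 (k l) := by exact_mod_cast h1
  rw [one_div, inv_mul_eq_div, lt_div_iff₀ hl'] at h2
  rw [← Real.le_logb_iff_rpow_le (by norm_num) (by exact_mod_cast hk l)]
  linarith

theorem le_asymptoticRate {k : ℕ → ℕ} (hk : ∀ l, 0 < k l) {R : ℝ}
    (h : ∀ᶠ l : ℕ in atTop, (2 : ℝ) ^ (l * R) ≤ k l) : (R : EReal) ≤ asymptoticRate k := by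
  refine le_liminf_of_le (by isBoundedDefault) ?_
  filter_upwards [h, eventually_gt_atTop 0] with l h1 hl
  have hl' : (0 : ℝ) < l := by exact_mod_cast hl
  rw [← Real.le_logb_iff_rpow_le (by norm_num) (by exact_mod_cast hk l)] at h1
  rw [EReal.coe_le_coe_iff, one_div, inv_mul_eq_div, le_div_iff₀ hl']
  linarith

theorem tendsto_two_div {k : ℕ → ℕ} {R : ℝ} (hR : 0 < R)
    (h : ∀ᶠ l : ℕ in atTop, (2 : ℝ) ^ (l * R) ≤ k l) :
    Tendsto (fun l => 2 / (k l : ℝ)) atTop (nhds 0) := by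
  have h1 : Tendsto (fun l : ℕ => (2 : ℝ) ^ (l * R)) atTop atTop := by
    have h2 : ∀ l : ℕ, (2 : ℝ) ^ (l * R) = ((2 : ℝ) ^ R) ^ l := fun l => by
      rw [mul_comm, Real.rpow_mul_natCast (by norm_num)]
    simp only [h2]
    exact tendsto_pow_atTop_atTop_of_one_lt (Real.one_lt_rpow (by norm_num) hR)
  exact tendsto_const_nhds.div_atTop (tendsto_atTop_mono' _ h h1)

/-- The dimension `m = ⌈2 ^ (l R')⌉` is small enough for the random subspace argument in dimension
`k ≥ 2 ^ (l R'')` with `R'' > R'`, since `k / m` grows exponentially in `l`, while the numbers of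
words and of net points and the precision `δ = 1 / (l + 1)` only contribute factors polynomial in
`l` to the exponent. -/
theorem eventually_union_bound (σ : ℕ) {R' R'' : ℝ} (hR' : 0 ≤ R') (hR : R' < R'') :
    ∀ᶠ l : ℕ in atTop, ∀ k : ℕ, (2 : ℝ) ^ (l * R'') ≤ k →
      (σ : ℝ) ^ l * (2 * (120 * ⌈(2 : ℝ) ^ (l * R')⌉₊ ^ 2 * (l + 1) : ℕ) + 1) ^
        (2 * ⌈(2 : ℝ) ^ (l * R')⌉₊) *
        Real.exp (-((1 / ((l : ℝ) + 1)) ^ 2 * k / 144)) < 1 / 2 := by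
  set c : ℝ := 9 + 2 * R' with hc
  set D : ℝ := 144 * (σ + 4 * c + 1) with hD
  have hgrow : ∀ᶠ l : ℕ in atTop, D * ((l : ℝ) + 1) ^ 3 < (2 : ℝ) ^ (l * (R'' - R')) := by
    have h1 : Tendsto (fun l : ℕ => (l : ℝ) ^ 3 / ((2 : ℝ) ^ (R'' - R')) ^ l) atTop (nhds 0) :=
      tendsto_pow_const_div_const_pow_of_one_lt 3
        (Real.one_lt_rpow (by norm_num) (sub_pos.mpr hR))
    have hDpos : 0 < D := by positivity
    have h2 := h1.eventually_lt_const (show 0 < 1 / (8 * D) by positivity)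
    filter_upwards [h2, eventually_ge_atTop 1] with l h3 hl
    have hl' : (1 : ℝ) ≤ l := by exact_mod_cast hl
    rw [mul_comm (l : ℝ), Real.rpow_mul_natCast (by norm_num)]
    rw [div_lt_div_iff₀ (by positivity) (by positivity), one_mul] at h3
    have h4 : ((l : ℝ) + 1) ^ 3 ≤ 8 * (l : ℝ) ^ 3 := by
      calc ((l : ℝ) + 1) ^ 3 ≤ (2 * l) ^ 3 := by gcongr; linarith
        _ = 8 * (l : ℝ) ^ 3 := by ring
    nlinarith
  filter_upwards [hgrow] with l hl k hk
  set M : ℝ := (2 : ℝ) ^ (l * R') with hM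
  set m : ℕ := ⌈M⌉₊ with hm
  have hl0 : (0 : ℝ) ≤ l := Nat.cast_nonneg l
  have hM1 : 1 ≤ M := Real.one_le_rpow (by norm_num) (by positivity)
  have hm2 : (m : ℝ) ≤ 2 * M := by
    have := Nat.ceil_lt_add_one (zero_le_one.trans hM1)
    linarith
  have hm1 : (1 : ℝ) ≤ m := hM1.trans (Nat.le_ceil M)
  have hMexp : M ≤ Real.exp (R' * l) := by
    rw [hM, Real.rpow_def_of_pos (by norm_num)]
    refine Real.exp_le_exp.mpr ?_
    have : Real.log 2 ≤ 1 := Real.log_two_lt_d9.le.trans (by norm_num)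
    nlinarith [mul_nonneg hR' hl0]
  have hbase : 2 * ((120 * m ^ 2 * (l + 1) : ℕ) : ℝ) + 1 ≤ Real.exp (c * (l + 1)) := by
    have h1 : 2 * ((120 * m ^ 2 * (l + 1) : ℕ) : ℝ) + 1 ≤ 241 * 4 * M ^ 2 * (l + 1) := by
      have h2 : (m : ℝ) ^ 2 ≤ 4 * M ^ 2 := by nlinarith
      have h3 : 1 ≤ 4 * M ^ 2 * (l + 1) := by nlinarith [mul_nonneg (sq_nonneg M) hl0]
      have h4 : (m : ℝ) ^ 2 * (l + 1) ≤ 4 * M ^ 2 * (l + 1) := by gcongr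
      push_cast
      nlinarith
    have h2 : (241 * 4 : ℝ) ≤ Real.exp 7 := by
      have h3 : (2.7 : ℝ) ≤ Real.exp 1 := by linarith [Real.exp_one_gt_d9]
      calc (241 * 4 : ℝ) ≤ 2.7 ^ 7 := by norm_num
        _ ≤ Real.exp 1 ^ 7 := by gcongr
        _ = Real.exp 7 := by rw [← Real.exp_nat_mul]; norm_num
    have h3 : M ^ 2 ≤ Real.exp (2 * (R' * l)) := by
      calc M ^ 2 ≤ Real.exp (R' * l) ^ 2 := by gcongr
        _ = Real.exp (2 * (R' * l)) := by rw [← Real.exp_nat_mul]; norm_num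
    have h4 : (l : ℝ) + 1 ≤ Real.exp l := Real.add_one_le_exp _
    calc _ ≤ 241 * 4 * M ^ 2 * ((l : ℝ) + 1) := h1
      _ ≤ Real.exp 7 * Real.exp (2 * (R' * l)) * Real.exp l := by gcongr
      _ = Real.exp (7 + 2 * (R' * l) + l) := by rw [Real.exp_add, Real.exp_add]
      _ ≤ Real.exp (c * (l + 1)) := by
          refine Real.exp_le_exp.mpr ?_
          rw [hc]
          nlinarith
  have hσ : (σ : ℝ) ^ l ≤ Real.exp (σ * l) := by
    calc (σ : ℝ) ^ l ≤ Real.exp σ ^ l := by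
          gcongr
          linarith [Real.add_one_le_exp (σ : ℝ)]
      _ = Real.exp (σ * l) := by rw [← Real.exp_nat_mul, mul_comm]
  have hnet : (2 * ((120 * m ^ 2 * (l + 1) : ℕ) : ℝ) + 1) ^ (2 * m) ≤
      Real.exp (4 * M * (c * (l + 1))) := by
    calc _ ≤ Real.exp (c * (l + 1)) ^ (2 * m) := by gcongr
      _ = Real.exp (2 * m * (c * (l + 1))) := by rw [← Real.exp_nat_mul]; push_cast; rfl
      _ ≤ _ := Real.exp_le_exp.mpr (by
          have : 0 ≤ c * ((l : ℝ) + 1) := by positivity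
          nlinarith)
  have hkM : D * ((l : ℝ) + 1) ^ 3 * M ≤ k := by
    refine le_trans ?_ hk
    have : (2 : ℝ) ^ (l * R'') = (2 : ℝ) ^ (l * (R'' - R')) * M := by
      rw [hM, ← Real.rpow_add (by norm_num)]
      congr 1
      ring
    rw [this]
    gcongr
  have hexp : σ * l + 4 * M * (c * (l + 1)) + -((1 / ((l : ℝ) + 1)) ^ 2 * k / 144) ≤ -1 := by
    have h1 : (σ + 4 * c + 1) * ((l : ℝ) + 1) * M ≤ (1 / ((l : ℝ) + 1)) ^ 2 * k / 144 := by
      rw [one_div, inv_pow, le_div_iff₀ (by norm_num), inv_mul_eq_div, le_div_iff₀ (by positivity)]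
      refine le_trans (le_of_eq ?_) hkM
      rw [hD]
      ring
    have h2 : (σ : ℝ) * l ≤ σ * (l + 1) * M := by
      have : (0 : ℝ) ≤ σ := Nat.cast_nonneg σ
      calc (σ : ℝ) * l ≤ σ * (l + 1) := by gcongr; linarith
        _ ≤ σ * (l + 1) * M := le_mul_of_one_le_right (by positivity) hM1
    nlinarith
  calc _ ≤ Real.exp (σ * l) * Real.exp (4 * M * (c * (l + 1))) *
        Real.exp (-((1 / ((l : ℝ) + 1)) ^ 2 * k / 144)) := by gcongr
    _ = Real.exp (σ * l + 4 * M * (c * (l + 1)) + -((1 / ((l : ℝ) + 1)) ^ 2 * k / 144)) := by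
        rw [Real.exp_add, Real.exp_add]
    _ ≤ Real.exp (-1) := Real.exp_le_exp.mpr hexp
    _ < 1 / 2 := by
        have := Real.exp_neg_one_lt_d9
        linarith

end Asymptotics

/-! ### Achievable rates -/

section Rates

variable {a b S : Type*} [Fintype a] [Fintype b] [DecidableEq a] [Finite S] [Nonempty S]
  {N : S → Channel a b} {lam : ℝ}

/-- The codes constructed from strong subspace transmission codes of positive rate: the loss
`2 / k` vanishes because `k` grows exponentially. -/
theorem exists_entanglementCodes {k : ℕ → ℕ} (C : ∀ l, RandomCode a b l (k l))
    (hC : ∀ l, (C l).IsStrongSubspaceCode N) {R : ℝ≥0} (hR : 0 < R)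
    (hk : ((R : ℝ) : EReal) ≤ asymptoticRate k)
    (hlam : 1 - lam ≤ liminf (fun l => (C l).strongSubspacePerformance N) atTop) :
    ∃ C' : ∀ l, RandomCode a b l (k l), (∀ l, (C' l).IsEntanglementCode N) ∧
      (∀ l, (C l).IsDeterministic → (C' l).IsDeterministic) ∧
      1 - lam ≤ liminf (fun l => (C' l).entanglementPerformance N) atTop := by
  choose C' hC' hdet hperf using fun l : ℕ =>
    (C l).exists_entanglementCode N (hC l) (ε := 1 / ((l : ℝ) + 1)) (by positivity)
  refine ⟨C', hC', hdet, le_liminf_of_sub_le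
    (fun l => ⟨(C l).strongSubspacePerformance_nonneg N, (C l).strongSubspacePerformance_le_one N⟩)
    (fun l => ⟨(C' l).entanglementPerformance_nonneg N, (C' l).entanglementPerformance_le_one N⟩)
    ?_ (Eventually.of_forall hperf) hlam⟩
  have hR' : (0 : ℝ) < R := hR
  have h1 := eventually_rpow_le_of_lt_asymptoticRate (fun l => (C l).pos)
    (lt_of_lt_of_le (EReal.coe_lt_coe_iff.mpr (half_lt_self hR')) hk)
  simpa using (tendsto_two_div (half_pos hR') h1).add tendsto_one_div_add_atTop_nhds_zero_nat

theorem StrongAchievableRandom.achievableRandom {R : ℝ≥0} (hR : 0 < R)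
    (h : StrongAchievableRandom N lam R) : AchievableRandom N lam R := by
  obtain ⟨k, C, hC, hk, hlam⟩ := h
  obtain ⟨C', h1, -, h2⟩ := exists_entanglementCodes C hC hR hk hlam
  exact ⟨k, C', h1, hk, h2⟩

theorem StrongAchievableDet.achievableDet {R : ℝ≥0} (hR : 0 < R)
    (h : StrongAchievableDet N lam R) : AchievableDet N lam R := by
  obtain ⟨k, C, hC, hdet, hk, hlam⟩ := h
  obtain ⟨C', h1, h2, h3⟩ := exists_entanglementCodes C hC hR hk hlam
  exact ⟨k, C', h1, fun l => h2 l (hdet l), hk, h3⟩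

theorem AchievableRandom.strongAchievableRandom {R : ℝ≥0} (h : AchievableRandom N lam R) :
    StrongAchievableRandom N lam R := by
  obtain ⟨k, C, hC, hk, hlam⟩ := h
  choose C' hC' hperf using fun l : ℕ =>
    (C l).exists_strongSubspaceCode N (hC l) (ε := 1 / ((l : ℝ) + 1)) (by positivity)
  exact ⟨k, C', hC', hk, le_liminf_of_sub_le
    (fun l => ⟨(C l).entanglementPerformance_nonneg N, (C l).entanglementPerformance_le_one N⟩)
    (fun l => ⟨(C' l).strongSubspacePerformance_nonneg N,
      (C' l).strongSubspacePerformance_le_one N⟩)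
    tendsto_one_div_add_atTop_nhds_zero_nat (Eventually.of_forall hperf) hlam⟩

/-- Deterministic codes lose an arbitrarily small part of the rate, since the code space is cut
down to a subspace. -/
theorem AchievableDet.strongAchievableDet {R R' : ℝ≥0} (hR : R' < R)
    (h : AchievableDet N lam R) : StrongAchievableDet N lam R' := by
  have := Fintype.ofFinite S
  obtain ⟨k, C, -, hdet, hk, hlam⟩ := h
  obtain ⟨R'', hR1, hR2⟩ := exists_between hR
  let m : ℕ → ℕ := fun l => ⌈(2 : ℝ) ^ (l * (R' : ℝ))⌉₊
  have hm : ∀ l, 0 < m l := fun l => Nat.ceil_pos.mpr (by positivity)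
  let P : ℕ → Prop := fun l => (Fintype.card S : ℝ) ^ l *
    (2 * (120 * m l ^ 2 * (l + 1) : ℕ) + 1) ^ (2 * m l) *
      Real.exp (-((1 / ((l : ℝ) + 1)) ^ 2 * k l / 144)) < 1 / 2
  have hP : ∀ᶠ l in atTop, P l := by
    have h1 := eventually_rpow_le_of_lt_asymptoticRate (fun l => (C l).pos)
      (lt_of_lt_of_le (EReal.coe_lt_coe_iff.mpr (NNReal.coe_lt_coe.mpr hR2)) hk)
    filter_upwards [h1, eventually_union_bound (Fintype.card S) R'.2 (NNReal.coe_lt_coe.mpr hR1)]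
      with l h1 h2
    exact h2 (k l) h1
  have hex : ∀ l, ∃ (m' : ℕ) (C' : RandomCode a b l m'), C'.IsStrongSubspaceCode N ∧
      C'.IsDeterministic ∧ (P l → m' = m l ∧ (C l).entanglementPerformance N -
        2 * (1 / ((l : ℝ) + 1)) ≤ C'.strongSubspacePerformance N) := by
    intro l
    by_cases hl : P l
    · have hl1 : (0 : ℝ) < (l : ℝ) + 1 := by positivity
      obtain ⟨C', h1, h2, h3⟩ := (C l).exists_deterministic_strongSubspaceCode N (hdet l) (hm l)
        (δ := 1 / ((l : ℝ) + 1)) (by positivity)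
        (by rw [div_le_one hl1]; linarith [Nat.cast_nonneg (α := ℝ) l])
        (n := 120 * m l ^ 2 * (l + 1)) (le_of_eq (by push_cast; field_simp)) hl
      exact ⟨m l, C', h1, h2, fun _ => ⟨rfl, h3⟩⟩
    · obtain ⟨C', h1, h2⟩ := (hdet l).exists_strongSubspaceCode N
      exact ⟨k l, C', h1, h2, fun h => absurd h hl⟩
  choose m' C' hC' hdet' hperf using hex
  refine ⟨m', C', hC', hdet', le_asymptoticRate (fun l => (C' l).pos) ?_, le_liminf_of_sub_le
    (fun l => ⟨(C l).entanglementPerformance_nonneg N, (C l).entanglementPerformance_le_one N⟩)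
    (fun l => ⟨(C' l).strongSubspacePerformance_nonneg N,
      (C' l).strongSubspacePerformance_le_one N⟩)
    (e := fun l : ℕ => 2 * (1 / ((l : ℝ) + 1))) ?_ (hP.mono fun l hl => (hperf l hl).2) hlam⟩
  · filter_upwards [hP] with l hl
    rw [(hperf l hl).1]
    exact Nat.le_ceil _
  · simpa using tendsto_one_div_add_atTop_nhds_zero_nat.const_mul (2 : ℝ)

end Rates

end AVQC

theorem mainTheorem9 {a b S : Type*} [Fintype a] [DecidableEq a] [Nonempty a]
    [Fintype b] [Nonempty b] [Finite S] [Nonempty S]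
    (N : S → AVQC.Channel a b) (lam : ℝ) (hlam : lam ∈ Set.Icc (0 : ℝ) 1) :
    AVQC.capDet N lam = AVQC.capStrongDet N lam ∧
      AVQC.capRandom N lam = AVQC.capStrongRandom N lam := by
  refine ⟨le_antisymm (iSup₂_le fun R hR => ?_) (iSup₂_le fun R hR => ?_),
    le_antisymm (iSup₂_le fun R hR => ?_) (iSup₂_le fun R hR => ?_)⟩
  · refine ENNReal.le_of_forall_nnreal_lt fun R' hR' => ?_
    exact le_iSup₂_of_le R' (hR.strongAchievableDet (ENNReal.coe_lt_coe.mp hR')) le_rfl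
  · rcases eq_zero_or_pos R with rfl | hpos
    · simp
    · exact le_iSup₂_of_le R (hR.achievableDet hpos) le_rfl
  · exact le_iSup₂_of_le R hR.strongAchievableRandom le_rfl
  · rcases eq_zero_or_pos R with rfl | hpos
    · simp
    · exact le_iSup₂_of_le R (hR.achievableRandom hpos) le_rfl
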